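/- Consider a discrete memoryless separated two-way relay channel with finite alphabets: nodes 1 and 2 send letters $X_{12}$ and $X_{21}$, the relay receives $Y_R$ with conditional law $p(y_R\mid x_{12},x_{21})$ and sends $X_R$, and nodes 1 and 2 receive $Y_1,Y_2$ with conditional law $p(y_1,y_2\mid x_R)=p(y_1\mid x_R)\,p(y_2\mid x_R)$. The network is full duplex: in a code of length $N$ the letter sent by the relay at time $i$ is a function of $Y_R^{i-1}$, and the letter sent by node $a$ at time $i$ is a function of its message and of $Y_a^{i-1}$. The messages are independent and uniform, and each node estimates the other node's message from its whole received sequence and its own message. A decode-and-forward code with message-level network coding has block length $n$, $B$ messages $w_{12}^{(b)}\in\{0,\dots,M_{12}-1\}$ and $w_{21}^{(b)}\in\{0,\dots,M_{21}-1\}$ in the two directions ($b=0,\dots,B-1$), and total length $N\ge (B+1)n$. In block $b$ the nodes send the length-$n$ codewords $x_{12}^n(w_{12}^{(b)})$ and $x_{21}^n(w_{21}^{(b)})$; from this block the relay decodes a pair $(\hat w_{12},\hat w_{21})$, and in block $b+1$ it sends the codeword $x_R^n(\lfloor \hat w_{12}/M_{21}\rfloor,\ (\hat w_{12}+\hat w_{21})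 \bmod M_{21})$ if $M_{12}\ge M_{21}$, and the codeword $x_R^n(\lfloor \hat w_{21}/M_{12}\rfloor,\ (\hat w_{12}+\hat w_{21}) \bmod M_{12})$ otherwise. Each node decodes the other node's $b$-th message from its received block $b+1$ and its own $b$-th message. All other periods are idle (fixed letters are sent). A pair $R_{12},R_{21}\ge 0$ is achieved by decode-and-forward if for every $\varepsilon>0$ and all sufficiently large $N$ there is such a code of length $N$ with $M_{12}^B\ge 2^{NR_{12}}$ and $M_{21}^B\ge 2^{NR_{21}}$ for which the probability that the relay decodes some pair incorrectly, and the probabilities that node 1 and that node 2 decode some message incorrectly, are each at most $\varepsilon$. **Theorem.** Let $p(x_{12})$, $p(x_{21})$, $p(x_R)$ be arbitrary input distributions, and let the mutual informations, in bits, be computed under $p(x_{12})p(x_{21})p(y_R\mid x_{12},x_{21})$ and $p(x_R)p(y_1\mid x_R)p(y_2\mid x_R)$. Then the closure of the set of pairs $R_{12},R_{21}\ge 0$ with $$R_{12}\le\min\{I(X_{12};Y_R\mid X_{21}),\,I(X_R;Y_2)\},\qquad R_{21}\le\min\{I(X_{21};Y_R\mid X_{12}),\,I(X_R;Y_1)\},$$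 $$R_{12}+R_{21}\le I(X_{12},X_{21};Y_R)$$ is contained in the closure of the set of rate pairs achieved by decode-and-forward. -/

import Mathlib

open scoped BigOperators

noncomputable section

namespace TwoWayRelay

/-- Mutual information `I(A;B)`, in bits, of a pair with joint probability mass function `P`
on finite alphabets. Terms with `P a b = 0` contribute `0`. -/
def mutualInfo {α β : Type*} [Fintype α] [Fintype β] (P : α → β → ℝ) : ℝ :=
  ∑ a, ∑ b, P a b * Real.logb 2 (P a b / ((∑ b', P a b') * (∑ a', P a' b)))

/-- Conditional mutual information `I(A;B|C)`, in bits, of a triple with joint probability mass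
function `P` on finite alphabets: the sum of
`P(a,b,c) log₂ (P(a,b,c) P(c) / (P(a,c) P(b,c)))`. -/
def condMutualInfo {α β γ : Type*} [Fintype α] [Fintype β] [Fintype γ] (P : α → β → γ → ℝ) : ℝ :=
  ∑ a, ∑ b, ∑ c, P a b c *
    Real.logb 2 (P a b c * (∑ a', ∑ b', P a' b' c) / ((∑ b', P a b' c) * (∑ a', P a' b c)))

/-- The one-letter transition probabilities of a discrete memoryless separated two-way relay
channel: uplink `p(y_R | x₁₂, x₂₁)` and downlink `p(y₁, y₂ | x_R) = p(y₁ | x_R) p(y₂ | x_R)`. -/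
structure Channel (X12 X21 XR YR Y1 Y2 : Type*) where
  up : X12 → X21 → PMF YR
  down1 : XR → PMF Y1
  down2 : XR → PMF Y2

/-- The letters of `y` received strictly before time `t`. -/
def past {N : ℕ} {Y : Type*} (y : Fin N → Y) (t : Fin N) : Fin t.val → Y :=
  fun i => y ⟨i.val, i.isLt.trans t.isLt⟩

/-- A full-duplex code of length `N` with message sets `W12` (from node 1 to node 2) and `W21`
(from node 2 to node 1). The letter sent at time `t` by a node is a function of its message and of
the letters it received before `t`; the letter sent by the relay is a function of the letters the
relay received before `t`. Node 1 estimates the message in `W21`, node 2 the one in `W12`, each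
from its whole received sequence and its own message. -/
structure Code (X12 X21 XR YR Y1 Y2 : Type*) (N : ℕ) (W12 W21 : Type) where
  f12 : (t : Fin N) → W12 → (Fin t.val → Y1) → X12
  f21 : (t : Fin N) → W21 → (Fin t.val → Y2) → X21
  fR : (t : Fin N) → (Fin t.val → YR) → XR
  g1 : (Fin N → Y1) → W12 → W21
  g2 : (Fin N → Y2) → W21 → W12

namespace Code

variable {X12 X21 XR YR Y1 Y2 : Type*} {N : ℕ} {W12 W21 : Type}

/-- The probability that the relay, node 1 and node 2 receive the sequences `yR`, `y1`, `y2` when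
the messages are `w12` and `w21` and the code `c` is used over the memoryless channel `ch`. -/
def outputProb (c : Code X12 X21 XR YR Y1 Y2 N W12 W21) (ch : Channel X12 X21 XR YR Y1 Y2)
    (w12 : W12) (w21 : W21) (yR : Fin N → YR) (y1 : Fin N → Y1) (y2 : Fin N → Y2) : ℝ :=
  ∏ t : Fin N,
    ((ch.up (c.f12 t w12 (past y1 t)) (c.f21 t w21 (past y2 t)) (yR t)).toReal *
      ((ch.down1 (c.fR t (past yR t)) (y1 t)).toReal *
        (ch.down2 (c.fR t (past yR t)) (y2 t)).toReal))

open Classical in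
/-- The probability of the event `E` when the two messages are independent and uniform. -/
def prob [Fintype YR] [Fintype Y1] [Fintype Y2] [Fintype W12] [Fintype W21]
    (c : Code X12 X21 XR YR Y1 Y2 N W12 W21) (ch : Channel X12 X21 XR YR Y1 Y2)
    (E : W12 → W21 → (Fin N → YR) → (Fin N → Y1) → (Fin N → Y2) → Prop) : ℝ :=
  ((Fintype.card W12 : ℝ) * (Fintype.card W21 : ℝ))⁻¹ *
    ∑ w12 : W12, ∑ w21 : W21, ∑ yR : Fin N → YR, ∑ y1 : Fin N → Y1, ∑ y2 : Fin N → Y2,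
      if E w12 w21 yR y1 y2 then c.outputProb ch w12 w21 yR y1 y2 else 0

/-- Probability that node 1 decodes the message of node 2 incorrectly. -/
def error1 [Fintype YR] [Fintype Y1] [Fintype Y2] [Fintype W12] [Fintype W21]
    (c : Code X12 X21 XR YR Y1 Y2 N W12 W21) (ch : Channel X12 X21 XR YR Y1 Y2) : ℝ :=
  c.prob ch fun w12 w21 _ y1 _ => c.g1 y1 w12 ≠ w21

/-- Probability that node 2 decodes the message of node 1 incorrectly. -/
def error2 [Fintype YR] [Fintype Y1] [Fintype Y2] [Fintype W12] [Fintype W21]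
    (c : Code X12 X21 XR YR Y1 Y2 N W12 W21) (ch : Channel X12 X21 XR YR Y1 Y2) : ℝ :=
  c.prob ch fun w12 w21 _ _ y2 => c.g2 y2 w21 ≠ w12

/-- The message sets carry at least `R12` and `R21` bits per channel use. -/
def HasRates [Fintype W12] [Fintype W21] (_c : Code X12 X21 XR YR Y1 Y2 N W12 W21)
    (R12 R21 : ℝ) : Prop :=
  (2 : ℝ) ^ ((N : ℝ) * R12) ≤ (Fintype.card W12 : ℝ) ∧
    (2 : ℝ) ^ ((N : ℝ) * R21) ≤ (Fintype.card W21 : ℝ)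

end Code

/-- Message-level network coding: the two-dimensional relay codebook is indexed by the high part
of the index from the larger message set and by the sum of both indices modulo the size of the
smaller message set. -/
def relayIndex {M12 M21 : ℕ} (w : Fin M12 × Fin M21) : ℕ × ℕ :=
  if M21 ≤ M12 then (w.1.val / M21, (w.1.val + w.2.val) % M21)
  else (w.2.val / M12, (w.1.val + w.2.val) % M12)

/-- The ingredients of a decode-and-forward scheme with blocks of length `n` and `M12`, `M21`
messages per block: uplink codebooks, a relay decoder for both indices, a relay codebook (of which
only the entries with indices in the range of `relayIndex` are used), the decoders of the two
nodes, which use their own index as side information, and letters to be sent in idle periods. -/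
structure DFScheme (X12 X21 XR YR Y1 Y2 : Type*) (n M12 M21 : ℕ) where
  x12 : Fin M12 → Fin n → X12
  x21 : Fin M21 → Fin n → X21
  decR : (Fin n → YR) → Fin M12 × Fin M21
  xR : ℕ × ℕ → Fin n → XR
  dec1 : (Fin n → Y1) → Fin M12 → Fin M21
  dec2 : (Fin n → Y2) → Fin M21 → Fin M12
  idle12 : X12
  idle21 : X21
  idleR : XR

/-- The `k`-th block of length `n` of a sequence of length `N`. -/
def block {Y : Type*} {n N : ℕ} (k : ℕ) (h : (k + 1) * n ≤ N) (y : Fin N → Y) : Fin n → Y :=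
  fun j => y ⟨k * n + j.val, by have := j.isLt; rw [Nat.add_mul] at h; omega⟩

/-- Time `t` lies in block number `t / n`, so the block before it is completely in the past. -/
theorem prev_block_le {t n : ℕ} (h : 0 < t / n) : (t / n - 1 + 1) * n ≤ t := by
  rw [Nat.sub_add_cancel h]; exact Nat.div_mul_le_self t n

/-- There are `B + 1` blocks in a sequence of length at least `(B + 1) * n`. -/
theorem block_le {B n N k : ℕ} (hN : (B + 1) * n ≤ N) (hk : k < B + 1) : (k + 1) * n ≤ N :=
  (Nat.mul_le_mul_right n hk).trans hN

namespace DFScheme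

variable {X12 X21 XR YR Y1 Y2 : Type*} {n M12 M21 : ℕ}

/-- The full-duplex code of length `N` obtained by pipelining the scheme over `B + 1` blocks
numbered `0, …, B`: the nodes send the codewords of their `b`-th indices in block `b < B`; in
block `b + 1` the relay sends the codeword for the pair of indices it decoded from block `b`, and
from that block the nodes decode the `b`-th index of the other node. The remaining periods
are idle. -/
def toCode (s : DFScheme X12 X21 XR YR Y1 Y2 n M12 M21) (hn : 0 < n) (B N : ℕ)
    (hN : (B + 1) * n ≤ N) :
    Code X12 X21 XR YR Y1 Y2 N (Fin B → Fin M12) (Fin B → Fin M21) where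
  f12 t w _ :=
    if h : t.val / n < B then s.x12 (w ⟨t.val / n, h⟩) ⟨t.val % n, Nat.mod_lt _ hn⟩
    else s.idle12
  f21 t w _ :=
    if h : t.val / n < B then s.x21 (w ⟨t.val / n, h⟩) ⟨t.val % n, Nat.mod_lt _ hn⟩
    else s.idle21
  fR t y :=
    if h : 0 < t.val / n ∧ t.val / n ≤ B then
      s.xR (relayIndex (s.decR (block (t.val / n - 1) (prev_block_le h.1) y)))
        ⟨t.val % n, Nat.mod_lt _ hn⟩
    else s.idleR
  g1 y w b := s.dec1 (block (b.val + 1) (block_le hN (Nat.succ_lt_succ b.isLt)) y) (w b)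
  g2 y w b := s.dec2 (block (b.val + 1) (block_le hN (Nat.succ_lt_succ b.isLt)) y) (w b)

/-- Probability that the relay decodes some pair of indices incorrectly. -/
def relayError [Fintype YR] [Fintype Y1] [Fintype Y2]
    (s : DFScheme X12 X21 XR YR Y1 Y2 n M12 M21) (hn : 0 < n) (B N : ℕ)
    (hN : (B + 1) * n ≤ N) (ch : Channel X12 X21 XR YR Y1 Y2) : ℝ :=
  (s.toCode hn B N hN).prob ch fun w12 w21 yR _ _ =>
    ∃ b : Fin B,
      s.decR (block b.val (block_le hN (b.isLt.trans (Nat.lt_succ_self B))) yR) ≠ (w12 b, w21 b)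

end DFScheme

/-- The pair of nonnegative rates `(R12, R21)` (bits per channel use) is achieved by
decode-and-forward relaying with message-level network coding: for all large lengths `N` there are
such codes of these rates for which the relay and both nodes decode with arbitrarily small
probability of error. -/
def DFAchievable {X12 X21 XR YR Y1 Y2 : Type*} [Fintype YR] [Fintype Y1] [Fintype Y2]
    (ch : Channel X12 X21 XR YR Y1 Y2) (R : ℝ × ℝ) : Prop :=
  0 ≤ R.1 ∧ 0 ≤ R.2 ∧
  ∀ ε : ℝ, 0 < ε → ∀ᶠ N : ℕ in Filter.atTop,
    ∃ (n B M12 M21 : ℕ) (hn : 0 < n) (hN : (B + 1) * n ≤ N)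
      (s : DFScheme X12 X21 XR YR Y1 Y2 n M12 M21),
      (s.toCode hn B N hN).HasRates R.1 R.2 ∧
      s.relayError hn B N hN ch ≤ ε ∧
      (s.toCode hn B N hN).error1 ch ≤ ε ∧
      (s.toCode hn B N hN).error2 ch ≤ ε

section Region

variable {X12 X21 XR YR Y1 Y2 : Type*}

/-- The uplink joint law `p(x₁₂) p(x₂₁) p(y_R | x₁₂, x₂₁)`. -/
def upLaw (ch : Channel X12 X21 XR YR Y1 Y2) (p12 : PMF X12) (p21 : PMF X21)
    (x12 : X12) (x21 : X21) (y : YR) : ℝ :=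
  (p12 x12).toReal * (p21 x21).toReal * (ch.up x12 x21 y).toReal

/-- The downlink joint law `p(x_R) p(y₁ | x_R)`. -/
def downLaw1 (ch : Channel X12 X21 XR YR Y1 Y2) (pR : PMF XR) (x : XR) (y : Y1) : ℝ :=
  (pR x).toReal * (ch.down1 x y).toReal

/-- The downlink joint law `p(x_R) p(y₂ | x_R)`. -/
def downLaw2 (ch : Channel X12 X21 XR YR Y1 Y2) (pR : PMF XR) (x : XR) (y : Y2) : ℝ :=
  (pR x).toReal * (ch.down2 x y).toReal

/-- The nonnegative rate pairs satisfying the decode-and-forward inequalities for the input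
distributions `p12`, `p21` and `pR`. -/
def dfRegion [Fintype X12] [Fintype X21] [Fintype XR] [Fintype YR] [Fintype Y1] [Fintype Y2]
    (ch : Channel X12 X21 XR YR Y1 Y2) (p12 : PMF X12) (p21 : PMF X21) (pR : PMF XR) :
    Set (ℝ × ℝ) :=
  {R | 0 ≤ R.1 ∧ 0 ≤ R.2 ∧
    R.1 ≤ min (condMutualInfo fun x12 y x21 => upLaw ch p12 p21 x12 x21 y)
      (mutualInfo (downLaw2 ch pR)) ∧
    R.2 ≤ min (condMutualInfo fun x21 y x12 => upLaw ch p12 p21 x12 x21 y)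
      (mutualInfo (downLaw1 ch pR)) ∧
    R.1 + R.2 ≤ mutualInfo fun (x : X12 × X21) y => upLaw ch p12 p21 x.1 x.2 y}

end Region

end TwoWayRelay

end

/-! The proof is random coding with likelihood ratio tests in place of typical sets. An independent
wrong codeword passes a test with threshold `γ` with probability at most `1/γ`, by a change of
measure (`sum_wrong_codeword_le`). The transmitted codeword fails the threshold `2^(nτ)`, with `τ`
below the mutual information, with exponentially small probability, by a Chernoff bound
(`exists_likelihood_ratio_bound`). On the uplink, a wrong pair differs from the true one in the
first index, the second or both; these cases give the two conditional bounds and the sum bound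
(`exists_mac_block_code`). On the downlink, `relayIndex` is injective once either index is fixed, so
a single codebook serves both nodes, and each node only has to tell apart as many codewords as the
other node has messages (`exists_broadcast_block_code`).

To pass from one block to the network, note that the nodes ignore what they receive while sending.
The relay's received sequence therefore has a product law given the messages, and the downlink
sequences have product laws given that sequence (`outputProb_toCode`). Marginalising to one block
(`sum_prod_comp`) and a union bound over blocks and hops (`two_hop_union_bound`) bound every error
by `B` times an average block error.

For `R` in the region and `c < 1`, a number `B` of blocks is fixed for which the pipelining loss
`B/(B+1)` is affordable, and the block length grows with `N`; thus `c • R` is achieved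
(`dfAchievable_smul`), and `c → 1` gives the inclusion of closures. Zero rates need care, since a
mutual information may itself vanish and leave no slack: there is then a single message, and the
error terms that need slack carry the factor `M - 1 = 0`. -/

open scoped BigOperators

noncomputable section

namespace TwoWayRelay

/-! ### Marginals of product distributions -/

section ProductSums

variable {ι κ α : Type*} [Fintype ι] [Fintype κ] [Fintype α]
  [DecidableEq ι] [DecidableEq κ]

theorem pmf_toReal_mem (p : PMF α) : (fun a => (p a).toReal) ∈ stdSimplex ℝ α := by
  refine ⟨fun a => ENNReal.toReal_nonneg, ?_⟩
  rw [← ENNReal.toReal_sum fun a _ => p.apply_ne_top a, ← tsum_fintype (L := .unconditional _),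
    p.tsum_coe, ENNReal.toReal_one]

theorem sum_prod_apply (f : ι → α → ℝ) :
    ∑ y : ι → α, ∏ i, f i (y i) = ∏ i, ∑ a, f i a := by
  rw [Finset.prod_univ_sum, Fintype.piFinset_univ]

/-- A product of probability mass functions is a probability mass function. -/
theorem prod_mem_stdSimplex {p : ι → α → ℝ} (hp : ∀ i, p i ∈ stdSimplex ℝ α) :
    (fun y : ι → α => ∏ i, p i (y i)) ∈ stdSimplex ℝ (ι → α) :=
  ⟨fun y => Finset.prod_nonneg fun i _ => (hp i).1 _, by
    rw [sum_prod_apply]; exact Finset.prod_eq_one fun i _ => (hp i).2⟩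

/-- Marginals of a product distribution along an injective choice of coordinates. -/
theorem sum_prod_comp {p : ι → α → ℝ} (hp : ∀ i, p i ∈ stdSimplex ℝ α) {φ : κ → ι}
    (hφ : Function.Injective φ) (F : (κ → α) → ℝ) :
    ∑ y : ι → α, (∏ i, p i (y i)) * F (fun k => y (φ k)) =
      ∑ z : κ → α, (∏ k, p (φ k) (z k)) * F z := by
  classical
  -- The event that the chosen coordinates equal `z` is an intersection of one condition per
  -- coordinate `i`, so its probability factors. Coordinates outside the range of `φ` carry an empty
  -- condition and contribute total mass one.
  have key : ∀ z : κ → α, ∏ k, p (φ k) (z k) =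
      ∑ y : ι → α, (∏ i, p i (y i)) * if (fun k => y (φ k)) = z then 1 else 0 := by
    intro z
    have h1 : ∀ y : ι → α, ((∏ i, p i (y i)) * if (fun k => y (φ k)) = z then 1 else 0) =
        ∏ i, (p i (y i) * if ∀ k, φ k = i → y i = z k then 1 else 0) := by
      intro y
      rw [Finset.prod_mul_distrib]
      congr 1
      rw [Finset.prod_ite_zero]
      simp only [Finset.prod_const_one, Finset.mem_univ, true_implies]
      refine if_congr ?_ rfl rfl
      constructor
      · rintro rfl i k rfl; rfl
      · intro h; funext k; exact h _ k rfl
    rw [Finset.sum_congr rfl fun y _ => h1 y,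
      sum_prod_apply fun i a => p i a * if ∀ k, φ k = i → a = z k then 1 else 0]
    refine Fintype.prod_of_injective φ hφ _ _ ?_ ?_
    · intro i hi
      refine Eq.trans ?_ (hp i).2
      refine Finset.sum_congr rfl fun a _ => ?_
      rw [if_pos, mul_one]
      intro k hk
      exact absurd ⟨k, hk⟩ hi
    · intro k
      rw [Finset.sum_eq_single (z k)]
      · rw [if_pos, mul_one]
        intro k' hk'
        rw [hφ hk']
      · intro a _ ha
        rw [if_neg, mul_zero]
        exact fun h => ha (h k rfl)
      · simp
  simp_rw [key, Finset.sum_mul]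
  rw [Finset.sum_comm]
  refine Finset.sum_congr rfl fun y _ => ?_
  rw [Finset.sum_eq_single fun k => y (φ k)]
  · simp
  · intro z _ hz
    simp [hz.symm]
  · simp

theorem sum_prod_apply_one {p : α → ℝ} (hp : p ∈ stdSimplex ℝ α) (i : ι) (F : α → ℝ) :
    ∑ y : ι → α, (∏ j, p (y j)) * F (y i) = ∑ a, p a * F a := by
  have := sum_prod_comp (ι := ι) (κ := Unit) (p := fun _ => p) (fun _ => hp)
    (φ := fun _ => i) (fun _ _ _ => rfl) (fun z => F (z ()))
  rw [this]
  exact Fintype.sum_equiv (Equiv.funUnique Unit α) _ _ fun z => by simp [Equiv.funUnique]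

theorem sum_prod_apply_two {p : α → ℝ} (hp : p ∈ stdSimplex ℝ α) {i j : ι} (hij : i ≠ j)
    (F : α → α → ℝ) :
    ∑ y : ι → α, (∏ k, p (y k)) * F (y i) (y j) = ∑ a, ∑ b, p a * p b * F a b := by
  have := sum_prod_comp (ι := ι) (κ := Fin 2) (p := fun _ => p) (fun _ => hp)
    (φ := ![i, j]) (by
      intro a b
      fin_cases a <;> fin_cases b <;> simp [hij, hij.symm]) (fun z => F (z 0) (z 1))
  simp only [Matrix.cons_val_zero, Matrix.cons_val_one] at this
  rw [this, ← Fintype.sum_prod_type' fun a b => p a * p b * F a b]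
  exact Fintype.sum_equiv (piFinTwoEquiv fun _ => α) _ _ fun z => by simp

/-- The average over all sequences of a function of one coordinate. -/
theorem average_apply [Nonempty α] (i : ι) (F : α → ℝ) :
    ((Fintype.card (ι → α) : ℝ))⁻¹ * ∑ y : ι → α, F (y i) =
      (Fintype.card α : ℝ)⁻¹ * ∑ a, F a := by
  have hp : (fun _ : α => (Fintype.card α : ℝ)⁻¹) ∈ stdSimplex ℝ α :=
    ⟨fun a => by positivity, by simp⟩
  have := sum_prod_apply_one hp i F
  simp only [Finset.prod_const, Finset.card_univ, ← Finset.mul_sum] at this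
  rw [← this, Fintype.card_fun]
  push_cast
  rw [inv_pow]

end ProductSums

/-! ### Indicators and union bounds -/

open Classical in
/-- The indicator of a proposition, as a real number. -/
def ind (p : Prop) : ℝ := if p then 1 else 0

theorem ind_nonneg (p : Prop) : 0 ≤ ind p := by
  unfold ind; split_ifs <;> norm_num

theorem ind_le_one (p : Prop) : ind p ≤ 1 := by
  unfold ind; split_ifs <;> norm_num

theorem ind_of {p : Prop} (h : p) : ind p = 1 := if_pos h

theorem ind_of_not {p : Prop} (h : ¬p) : ind p = 0 := if_neg h

theorem ind_mono {p q : Prop} (h : p → q) : ind p ≤ ind q := by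
  by_cases hp : p
  · rw [ind_of hp, ind_of (h hp)]
  · rw [ind_of_not hp]; exact ind_nonneg q

theorem ind_or_le (p q : Prop) : ind (p ∨ q) ≤ ind p + ind q := by
  by_cases hp : p
  · rw [ind_of hp]; linarith [ind_nonneg q, ind_le_one (p ∨ q)]
  · simp [hp, ind_nonneg]

theorem ind_exists_le {ι : Type*} [Fintype ι] (p : ι → Prop) : ind (∃ i, p i) ≤ ∑ i, ind (p i) := by
  by_cases h : ∃ i, p i
  · obtain ⟨i, hi⟩ := h
    rw [ind_of ⟨i, hi⟩, ← ind_of hi]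
    exact Finset.single_le_sum (f := fun i => ind (p i)) (fun i _ => ind_nonneg _)
      (Finset.mem_univ i)
  · rw [ind_of_not h]
    exact Finset.sum_nonneg fun i _ => ind_nonneg _

theorem sum_mul_ind_exists_le {A β : Type*} [Fintype A] [Fintype β] {P : A → ℝ}
    (hP : P ∈ stdSimplex ℝ A) (R : β → A → Prop) :
    ∑ a, P a * ind (∃ b, R b a) ≤ ∑ b, ∑ a, P a * ind (R b a) := by
  rw [Finset.sum_comm]
  refine Finset.sum_le_sum fun a _ => ?_
  rw [← Finset.mul_sum]
  exact mul_le_mul_of_nonneg_left (ind_exists_le _) (hP.1 a)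

/-- Union bound for two hops: if the event `G b` of the second hop has probability `e b` whenever
the event `R b` of the first hop does not occur, then some `G b` occurs with probability at most
the sum of all probabilities. -/
theorem two_hop_union_bound {A C β : Type*} [Fintype A] [Fintype C] [Fintype β] {P : A → ℝ}
    (hP : P ∈ stdSimplex ℝ A) {D : A → C → ℝ} (hD : ∀ a, D a ∈ stdSimplex ℝ C)
    (R : β → A → Prop) (G : β → C → Prop) {e : β → ℝ} (he : ∀ b, 0 ≤ e b)
    (h : ∀ b a, ¬R b a → ∑ c, D a c * ind (G b c) = e b) :
    ∑ a, P a * ∑ c, D a c * ind (∃ b, G b c) ≤ ∑ b, (∑ a, P a * ind (R b a) + e b) := by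
  have h1 : ∀ a b, ∑ c, D a c * ind (G b c) ≤ ind (R b a) + e b := by
    intro a b
    -- A failed first hop is charged to `R b` alone, the second hop being bounded by one.
    by_cases hR : R b a
    · rw [ind_of hR]
      have : ∑ c, D a c * ind (G b c) ≤ ∑ c, D a c :=
        Finset.sum_le_sum fun c _ => mul_le_of_le_one_right ((hD a).1 c) (ind_le_one _)
      linarith [he b, (hD a).2]
    · rw [h b a hR, ind_of_not hR, zero_add]
  calc ∑ a, P a * ∑ c, D a c * ind (∃ b, G b c)
      ≤ ∑ a, P a * ∑ b, (ind (R b a) + e b) :=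
        Finset.sum_le_sum fun a _ => mul_le_mul_of_nonneg_left
          ((sum_mul_ind_exists_le (hD a) G).trans (Finset.sum_le_sum fun b _ => h1 a b)) (hP.1 a)
    _ = ∑ b, (∑ a, P a * ind (R b a) + e b) := by
        simp_rw [Finset.mul_sum]
        rw [Finset.sum_comm]
        refine Finset.sum_congr rfl fun b _ => ?_
        simp_rw [mul_add]
        rw [Finset.sum_add_distrib, ← Finset.sum_mul, hP.2, one_mul]

/-- The average over uniform index pairs. -/
def pairAverage {K L : Type*} [Fintype K] [Fintype L] (e : K → L → ℝ) : ℝ :=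
  ((Fintype.card K : ℝ) * Fintype.card L)⁻¹ * ∑ k, ∑ l, e k l

/-! ### Reduction of the pipelined code to single blocks -/

namespace DFScheme

variable {X12 X21 XR YR Y1 Y2 : Type*} {n M12 M21 : ℕ}

/-- Probability that the relay decodes the index pair `(m, m')` of a block incorrectly. -/
def relayBlockError [Fintype YR] (s : DFScheme X12 X21 XR YR Y1 Y2 n M12 M21)
    (ch : Channel X12 X21 XR YR Y1 Y2) (m : Fin M12) (m' : Fin M21) : ℝ :=
  ∑ y : Fin n → YR, (∏ j, (ch.up (s.x12 m j) (s.x21 m' j) (y j)).toReal) *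
    ind (s.decR y ≠ (m, m'))

/-- Probability that node 1 decodes `m'` incorrectly if the relay sends the codeword of
`(m, m')`. -/
def blockError1 [Fintype Y1] (s : DFScheme X12 X21 XR YR Y1 Y2 n M12 M21)
    (ch : Channel X12 X21 XR YR Y1 Y2) (m : Fin M12) (m' : Fin M21) : ℝ :=
  ∑ y : Fin n → Y1, (∏ j, (ch.down1 (s.xR (relayIndex (m, m')) j) (y j)).toReal) *
    ind (s.dec1 y m ≠ m')

/-- Probability that node 2 decodes `m` incorrectly if the relay sends the codeword of
`(m, m')`. -/
def blockError2 [Fintype Y2] (s : DFScheme X12 X21 XR YR Y1 Y2 n M12 M21)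
    (ch : Channel X12 X21 XR YR Y1 Y2) (m : Fin M12) (m' : Fin M21) : ℝ :=
  ∑ y : Fin n → Y2, (∏ j, (ch.down2 (s.xR (relayIndex (m, m')) j) (y j)).toReal) *
    ind (s.dec2 y m' ≠ m)

variable (s : DFScheme X12 X21 XR YR Y1 Y2 n M12 M21) (hn : 0 < n) (B N : ℕ)

/-- The letter sent by node 1 at time `t`. -/
def letter12 (w : Fin B → Fin M12) (t : ℕ) : X12 :=
  if h : t / n < B then s.x12 (w ⟨t / n, h⟩) ⟨t % n, Nat.mod_lt _ hn⟩ else s.idle12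

/-- The letter sent by node 2 at time `t`. -/
def letter21 (w : Fin B → Fin M21) (t : ℕ) : X21 :=
  if h : t / n < B then s.x21 (w ⟨t / n, h⟩) ⟨t % n, Nat.mod_lt _ hn⟩ else s.idle21

variable {B N}

/-- The letter sent by the relay at time `t` if it receives the sequence `y`. -/
def letterR (hN : (B + 1) * n ≤ N) (y : Fin N → YR) (t : Fin N) : XR :=
  (s.toCode hn B N hN).fR t (past y t)

/-- The node letters do not depend on received letters, and the relay letters depend on `yR` only.
So the causal product splits into a law of `yR` and two kernels from `yR`, each of product form. -/
theorem outputProb_toCode (hN : (B + 1) * n ≤ N) (ch : Channel X12 X21 XR YR Y1 Y2)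
    (w : Fin B → Fin M12) (w' : Fin B → Fin M21) (yR : Fin N → YR) (y1 : Fin N → Y1)
    (y2 : Fin N → Y2) :
    (s.toCode hn B N hN).outputProb ch w w' yR y1 y2 =
      (∏ t : Fin N, (ch.up (s.letter12 hn B w t) (s.letter21 hn B w' t) (yR t)).toReal) *
        ((∏ t, (ch.down1 (s.letterR hn hN yR t) (y1 t)).toReal) *
          ∏ t, (ch.down2 (s.letterR hn hN yR t) (y2 t)).toReal) := by
  rw [← Finset.prod_mul_distrib, ← Finset.prod_mul_distrib]
  rfl

/-- The times of the `k`-th block. -/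
def blockTime (k : ℕ) (h : (k + 1) * n ≤ N) (j : Fin n) : Fin N :=
  ⟨k * n + j.val, by have := j.isLt; rw [Nat.add_mul] at h; omega⟩

theorem blockTime_injective (k : ℕ) (h : (k + 1) * n ≤ N) :
    Function.Injective (blockTime k h) := by
  intro i j hij
  have := congrArg Fin.val hij
  simp only [blockTime, Nat.add_left_cancel_iff] at this
  exact Fin.ext this

theorem blockTime_div (k : ℕ) (h : (k + 1) * n ≤ N) (j : Fin n) :
    (blockTime k h j).val / n = k := by
  have hn : 0 < n := j.pos
  simp only [blockTime]
  rw [mul_comm, Nat.mul_add_div hn, Nat.div_eq_of_lt j.isLt, add_zero]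

theorem blockTime_mod (k : ℕ) (h : (k + 1) * n ≤ N) (j : Fin n) :
    (blockTime k h j).val % n = j.val := by
  simp only [blockTime]
  rw [mul_comm, Nat.mul_add_mod, Nat.mod_eq_of_lt j.isLt]

theorem letter12_blockTime (w : Fin B → Fin M12) (b : Fin B) (h : (b.val + 1) * n ≤ N)
    (j : Fin n) : s.letter12 hn B w (blockTime b.val h j) = s.x12 (w b) j := by
  unfold letter12
  rw [dif_pos (by rw [blockTime_div]; exact b.isLt)]
  exact congrArg₂ (fun m i => s.x12 (w m) i) (Fin.ext (blockTime_div b.val h j))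
    (Fin.ext (blockTime_mod b.val h j))

theorem letter21_blockTime (w : Fin B → Fin M21) (b : Fin B) (h : (b.val + 1) * n ≤ N)
    (j : Fin n) : s.letter21 hn B w (blockTime b.val h j) = s.x21 (w b) j := by
  unfold letter21
  rw [dif_pos (by rw [blockTime_div]; exact b.isLt)]
  exact congrArg₂ (fun m i => s.x21 (w m) i) (Fin.ext (blockTime_div b.val h j))
    (Fin.ext (blockTime_mod b.val h j))

theorem block_congr {Y : Type*} {k k' : ℕ} (hk : k = k') (h : (k + 1) * n ≤ N)
    (h' : (k' + 1) * n ≤ N) (y : Fin N → Y) : block k h y = block k' h' y := by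
  subst hk; rfl

/-- In block `b + 1` the relay's past contains all of block `b`, and the bound `b + 1 ≤ B` required
by `fR` is just `b < B`. -/
theorem letterR_blockTime (hN : (B + 1) * n ≤ N) (y : Fin N → YR) (b : Fin B)
    (h : (b.val + 1) * n ≤ N) (h' : (b.val + 1 + 1) * n ≤ N) (j : Fin n) :
    s.letterR hn hN y (blockTime (b.val + 1) h' j) =
      s.xR (relayIndex (s.decR (block b.val h y))) j := by
  have hb := blockTime_div (b.val + 1) h' j
  unfold letterR toCode
  simp only
  rw [dif_pos (by rw [hb]; exact ⟨Nat.succ_pos _, b.isLt⟩)]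
  have h2 : block ((blockTime (b.val + 1) h' j).val / n - 1)
      (prev_block_le (by rw [hb]; exact Nat.succ_pos _)) (past y (blockTime (b.val + 1) h' j)) =
      block b.val h y := by
    refine Eq.trans ?_ (block_congr (k := (blockTime (b.val + 1) h' j).val / n - 1)
      (by rw [hb]; rfl) (by rw [hb]; exact h) h y)
    rfl
  rw [h2]
  congr 1
  exact Fin.ext (blockTime_mod _ _ _)

theorem sum_up_block [Fintype YR] (hN : (B + 1) * n ≤ N) (ch : Channel X12 X21 XR YR Y1 Y2)
    (w : Fin B → Fin M12) (w' : Fin B → Fin M21) (b : Fin B) :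
    ∑ y : Fin N → YR,
      (∏ t : Fin N, (ch.up (s.letter12 hn B w t) (s.letter21 hn B w' t) (y t)).toReal) *
        ind (s.decR (block b.val (block_le hN (b.isLt.trans (Nat.lt_succ_self B))) y) ≠
          (w b, w' b)) = s.relayBlockError ch (w b) (w' b) := by
  have h := block_le hN (b.isLt.trans (Nat.lt_succ_self B))
  refine (sum_prod_comp
    (p := fun t : Fin N => fun a =>
      (ch.up (s.letter12 hn B w t) (s.letter21 hn B w' t) a).toReal)
    (fun t => pmf_toReal_mem _) (blockTime_injective b.val h)
    (fun z => ind (s.decR z ≠ (w b, w' b)))).trans ?_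
  unfold relayBlockError
  simp only [letter12_blockTime, letter21_blockTime]

/-- A correct decision on block `b` fixes the relay codeword of block `b + 1`, whatever the relay
decided elsewhere; the other blocks are summed out. The value does not depend on `yR` otherwise, as
`two_hop_union_bound` requires. -/
theorem sum_down1_block [Fintype Y1] (hN : (B + 1) * n ≤ N) (ch : Channel X12 X21 XR YR Y1 Y2)
    (w : Fin B → Fin M12) (w' : Fin B → Fin M21) (b : Fin B) (yR : Fin N → YR)
    (hR : s.decR (block b.val (block_le hN (b.isLt.trans (Nat.lt_succ_self B))) yR) =
      (w b, w' b)) :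
    ∑ y : Fin N → Y1, (∏ t, (ch.down1 (s.letterR hn hN yR t) (y t)).toReal) *
      ind (s.dec1 (block (b.val + 1) (block_le hN (Nat.succ_lt_succ b.isLt)) y) (w b) ≠ w' b) =
      s.blockError1 ch (w b) (w' b) := by
  have h := block_le hN (Nat.succ_lt_succ b.isLt)
  refine (sum_prod_comp (p := fun t => fun a => (ch.down1 (s.letterR hn hN yR t) a).toReal)
    (fun t => pmf_toReal_mem _) (blockTime_injective (b.val + 1) h)
    (fun z => ind (s.dec1 z (w b) ≠ w' b))).trans ?_
  unfold blockError1
  simp only [s.letterR_blockTime hn hN yR b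
    (block_le hN (b.isLt.trans (Nat.lt_succ_self B))) h, hR]

theorem sum_down2_block [Fintype Y2] (hN : (B + 1) * n ≤ N) (ch : Channel X12 X21 XR YR Y1 Y2)
    (w : Fin B → Fin M12) (w' : Fin B → Fin M21) (b : Fin B) (yR : Fin N → YR)
    (hR : s.decR (block b.val (block_le hN (b.isLt.trans (Nat.lt_succ_self B))) yR) =
      (w b, w' b)) :
    ∑ y : Fin N → Y2, (∏ t, (ch.down2 (s.letterR hn hN yR t) (y t)).toReal) *
      ind (s.dec2 (block (b.val + 1) (block_le hN (Nat.succ_lt_succ b.isLt)) y) (w' b) ≠ w b) =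
      s.blockError2 ch (w b) (w' b) := by
  have h := block_le hN (Nat.succ_lt_succ b.isLt)
  refine (sum_prod_comp (p := fun t => fun a => (ch.down2 (s.letterR hn hN yR t) a).toReal)
    (fun t => pmf_toReal_mem _) (blockTime_injective (b.val + 1) h)
    (fun z => ind (s.dec2 z (w' b) ≠ w b))).trans ?_
  unfold blockError2
  simp only [s.letterR_blockTime hn hN yR b
    (block_le hN (b.isLt.trans (Nat.lt_succ_self B))) h, hR]

/-- For uniform message sequences, the pair of `b`-th indices is uniform for every `b`, so all `B`
blocks contribute the same average. -/
theorem prob_le_of_sum_le [Fintype YR] [Fintype Y1] [Fintype Y2]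
    {W W' : Type} [Fintype W] [Fintype W'] [Nonempty W] [Nonempty W']
    (c : Code X12 X21 XR YR Y1 Y2 N (Fin B → W) (Fin B → W'))
    (ch : Channel X12 X21 XR YR Y1 Y2)
    (E : (Fin B → W) → (Fin B → W') → (Fin N → YR) → (Fin N → Y1) → (Fin N → Y2) → Prop)
    (e : W → W' → ℝ)
    (h : ∀ w w', ∑ yR, ∑ y1, ∑ y2, c.outputProb ch w w' yR y1 y2 * ind (E w w' yR y1 y2) ≤
      ∑ b, e (w b) (w' b)) :
    c.prob ch E ≤ B * pairAverage e := by
  classical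
  have h1 : c.prob ch E ≤
      ((Fintype.card (Fin B → W) : ℝ) * (Fintype.card (Fin B → W') : ℝ))⁻¹ *
        ∑ w : Fin B → W, ∑ w' : Fin B → W', ∑ b, e (w b) (w' b) := by
    unfold Code.prob
    refine mul_le_mul_of_nonneg_left (Finset.sum_le_sum fun w _ => Finset.sum_le_sum fun w' _ => ?_)
      (by positivity)
    refine le_trans (le_of_eq ?_) (h w w')
    simp only [ind, mul_ite, mul_one, mul_zero]
  refine h1.trans (le_of_eq ?_)
  have h2 : ∀ b : Fin B, ((Fintype.card (Fin B → W) : ℝ) * (Fintype.card (Fin B → W') : ℝ))⁻¹ *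
      ∑ w : Fin B → W, ∑ w' : Fin B → W', e (w b) (w' b) =
      pairAverage e := by
    intro b
    unfold pairAverage
    have h3 := average_apply (α := W) b fun m =>
      (Fintype.card (Fin B → W') : ℝ)⁻¹ * ∑ w' : Fin B → W', e m (w' b)
    rw [mul_inv, mul_assoc, Finset.mul_sum (a := (Fintype.card (Fin B → W') : ℝ)⁻¹), h3, mul_inv,
      mul_assoc, Finset.mul_sum (a := (Fintype.card W' : ℝ)⁻¹)]
    congr 1
    exact Finset.sum_congr rfl fun m _ => average_apply (α := W') b fun m' => e m m'
  have h4 : ∑ w : Fin B → W, ∑ w' : Fin B → W', ∑ b, e (w b) (w' b) =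
      ∑ b, ∑ w : Fin B → W, ∑ w' : Fin B → W', e (w b) (w' b) := by
    rw [Finset.sum_comm (s := (Finset.univ : Finset (Fin B)))]
    exact Finset.sum_congr rfl fun w _ => Finset.sum_comm
  rw [h4, Finset.mul_sum, Finset.sum_congr rfl fun b _ => h2 b]
  simp

theorem blockError1_nonneg [Fintype Y1] (ch : Channel X12 X21 XR YR Y1 Y2)
    (m : Fin M12) (m' : Fin M21) : 0 ≤ s.blockError1 ch m m' :=
  Finset.sum_nonneg fun _ _ => mul_nonneg
    (Finset.prod_nonneg fun _ _ => ENNReal.toReal_nonneg) (ind_nonneg _)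

theorem blockError2_nonneg [Fintype Y2] (ch : Channel X12 X21 XR YR Y1 Y2)
    (m : Fin M12) (m' : Fin M21) : 0 ≤ s.blockError2 ch m m' :=
  Finset.sum_nonneg fun _ _ => mul_nonneg
    (Finset.prod_nonneg fun _ _ => ENNReal.toReal_nonneg) (ind_nonneg _)

variable [Fintype YR] [Fintype Y1] [Fintype Y2] [NeZero M12] [NeZero M21]

theorem relayError_le (hN : (B + 1) * n ≤ N) (ch : Channel X12 X21 XR YR Y1 Y2) :
    s.relayError hn B N hN ch ≤ B * pairAverage (s.relayBlockError ch) := by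
  refine prob_le_of_sum_le _ ch _ (s.relayBlockError ch) fun w w' => ?_
  simp_rw [outputProb_toCode]
  refine le_trans (le_of_eq ?_) ((sum_mul_ind_exists_le (prod_mem_stdSimplex fun t : Fin N =>
    pmf_toReal_mem (ch.up (s.letter12 hn B w t) (s.letter21 hn B w' t))) fun (b : Fin B) y =>
      s.decR (block b.val (block_le hN (b.isLt.trans (Nat.lt_succ_self B))) y) ≠
        (w b, w' b)).trans (le_of_eq (Finset.sum_congr rfl fun b _ =>
          s.sum_up_block hn hN ch w w' b)))
  refine Finset.sum_congr rfl fun yR _ => ?_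
  -- The event concerns `yR` only, so both downlink kernels sum to one.
  have h1 := (prod_mem_stdSimplex fun t => pmf_toReal_mem (ch.down1 (s.letterR hn hN yR t))).2
  have h2 := (prod_mem_stdSimplex fun t => pmf_toReal_mem (ch.down2 (s.letterR hn hN yR t))).2
  simp only [← Finset.sum_mul, ← Finset.mul_sum, h1, h2, mul_one]

theorem error1_le (hN : (B + 1) * n ≤ N) (ch : Channel X12 X21 XR YR Y1 Y2) :
    (s.toCode hn B N hN).error1 ch ≤
      B * pairAverage fun m m' => s.relayBlockError ch m m' + s.blockError1 ch m m' := by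
  refine prob_le_of_sum_le _ ch _ (fun m m' => s.relayBlockError ch m m' + s.blockError1 ch m m')
    fun w w' => ?_
  simp_rw [outputProb_toCode]
  have key := two_hop_union_bound (prod_mem_stdSimplex fun t : Fin N =>
    pmf_toReal_mem (ch.up (s.letter12 hn B w t) (s.letter21 hn B w' t)))
    (fun yR => prod_mem_stdSimplex fun t => pmf_toReal_mem (ch.down1 (s.letterR hn hN yR t)))
    (fun (b : Fin B) y =>
      s.decR (block b.val (block_le hN (b.isLt.trans (Nat.lt_succ_self B))) y) ≠ (w b, w' b))
    (fun (b : Fin B) y =>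
      s.dec1 (block (b.val + 1) (block_le hN (Nat.succ_lt_succ b.isLt)) y) (w b) ≠ w' b)
    (fun b => s.blockError1_nonneg ch (w b) (w' b))
    (fun b yR hR => s.sum_down1_block hn hN ch w w' b yR (not_not.mp hR))
  simp only [s.sum_up_block hn hN ch w w'] at key
  refine le_trans (le_of_eq ?_) key
  refine Finset.sum_congr rfl fun yR _ => ?_
  rw [Finset.mul_sum]
  refine Finset.sum_congr rfl fun y1 _ => ?_
  have h2 := (prod_mem_stdSimplex fun t => pmf_toReal_mem (ch.down2 (s.letterR hn hN yR t))).2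
  have hE : (∃ b, s.dec1 (block (b.val + 1) (block_le hN (Nat.succ_lt_succ b.isLt)) y1) (w b) ≠
      w' b) ↔ (s.toCode hn B N hN).g1 y1 w ≠ w' := Function.ne_iff.symm
  simp only [← Finset.sum_mul, ← Finset.mul_sum, h2, one_mul, hE, mul_assoc]

theorem error2_le (hN : (B + 1) * n ≤ N) (ch : Channel X12 X21 XR YR Y1 Y2) :
    (s.toCode hn B N hN).error2 ch ≤
      B * pairAverage fun m m' => s.relayBlockError ch m m' + s.blockError2 ch m m' := by
  refine prob_le_of_sum_le _ ch _ (fun m m' => s.relayBlockError ch m m' + s.blockError2 ch m m')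
    fun w w' => ?_
  simp_rw [outputProb_toCode]
  have key := two_hop_union_bound (prod_mem_stdSimplex fun t : Fin N =>
    pmf_toReal_mem (ch.up (s.letter12 hn B w t) (s.letter21 hn B w' t)))
    (fun yR => prod_mem_stdSimplex fun t => pmf_toReal_mem (ch.down2 (s.letterR hn hN yR t)))
    (fun (b : Fin B) y =>
      s.decR (block b.val (block_le hN (b.isLt.trans (Nat.lt_succ_self B))) y) ≠ (w b, w' b))
    (fun (b : Fin B) y =>
      s.dec2 (block (b.val + 1) (block_le hN (Nat.succ_lt_succ b.isLt)) y) (w' b) ≠ w b)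
    (fun b => s.blockError2_nonneg ch (w b) (w' b))
    (fun b yR hR => s.sum_down2_block hn hN ch w w' b yR (not_not.mp hR))
  simp only [s.sum_up_block hn hN ch w w'] at key
  refine le_trans (le_of_eq ?_) key
  refine Finset.sum_congr rfl fun yR _ => ?_
  have h1 := (prod_mem_stdSimplex fun t => pmf_toReal_mem (ch.down1 (s.letterR hn hN yR t))).2
  rw [Finset.sum_comm, Finset.mul_sum]
  refine Finset.sum_congr rfl fun y2 _ => ?_
  have hE : (∃ b, s.dec2 (block (b.val + 1) (block_le hN (Nat.succ_lt_succ b.isLt)) y2) (w' b) ≠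
      w b) ↔ (s.toCode hn B N hN).g2 y2 w' ≠ w := Function.ne_iff.symm
  simp only [← Finset.sum_mul, ← Finset.mul_sum, h1, one_mul, hE, mul_assoc]

end DFScheme

/-! ### Random coding with threshold tests -/

theorem exists_le_of_sum_mul_le {X : Type*} [Fintype X] {P : X → ℝ} (hP : P ∈ stdSimplex ℝ X)
    {F : X → ℝ} {β : ℝ} (h : ∑ x, P x * F x ≤ β) : ∃ x, F x ≤ β := by
  by_contra! hF
  have h1 : ∃ x, 0 < P x := by
    by_contra! h0
    have : ∑ x, P x ≤ 0 := Finset.sum_nonpos fun x _ => h0 x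
    linarith [hP.2]
  obtain ⟨x, hx⟩ := h1
  have h2 : ∑ x, P x * β < ∑ x, P x * F x :=
    Finset.sum_lt_sum (fun y _ => mul_le_mul_of_nonneg_left (hF y).le (hP.1 y))
      ⟨x, Finset.mem_univ x, mul_lt_mul_of_pos_left (hF x) hx⟩
  rw [← Finset.sum_mul, hP.2, one_mul] at h2
  linarith

theorem sum_mul_le_of_le {X : Type*} [Fintype X] {P : X → ℝ} (hP : P ∈ stdSimplex ℝ X)
    {F : X → ℝ} {β : ℝ} (h : ∀ x, F x ≤ β) : ∑ x, P x * F x ≤ β := by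
  calc ∑ x, P x * F x ≤ ∑ x, P x * β :=
        Finset.sum_le_sum fun x _ => mul_le_mul_of_nonneg_left (h x) (hP.1 x)
    _ = β := by rw [← Finset.sum_mul, hP.2, one_mul]

theorem sum_mul_nonneg {X : Type*} [Fintype X] {P : X → ℝ} (hP : P ∈ stdSimplex ℝ X)
    {F : X → ℝ} (h : ∀ x, 0 ≤ F x) : 0 ≤ ∑ x, P x * F x :=
  Finset.sum_nonneg fun x _ => mul_nonneg (hP.1 x) (h x)

theorem prod_mem_stdSimplex_two {A B : Type*} [Fintype A] [Fintype B] {p : A → ℝ} {q : B → ℝ}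
    (hp : p ∈ stdSimplex ℝ A) (hq : q ∈ stdSimplex ℝ B) :
    (fun x : A × B => p x.1 * q x.2) ∈ stdSimplex ℝ (A × B) := by
  refine ⟨fun x => mul_nonneg (hp.1 _) (hq.1 _), ?_⟩
  rw [Fintype.sum_prod_type]
  simp only [← Finset.mul_sum, hq.2, mul_one, hp.2]

/-- Averaging argument: a random object that is good on average for each index pair can be chosen
to be good for the average index pair. -/
theorem exists_pairAverage_le {X K L : Type*} [Fintype X] [Fintype K] [Fintype L] [Nonempty K]
    [Nonempty L] {P : X → ℝ} (hP : P ∈ stdSimplex ℝ X) {F : X → K → L → ℝ} {β : ℝ}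
    (h : ∀ k l, ∑ x, P x * F x k l ≤ β) : ∃ x, pairAverage (F x) ≤ β := by
  refine exists_le_of_sum_mul_le hP ?_
  have h1 : ∑ x, P x * pairAverage (F x) = pairAverage fun k l => ∑ x, P x * F x k l := by
    unfold pairAverage
    simp_rw [mul_left_comm (P _), ← Finset.mul_sum]
    congr 1
    simp_rw [Finset.mul_sum]
    rw [Finset.sum_comm]
    exact Finset.sum_congr rfl fun k _ => Finset.sum_comm
  rw [h1]
  unfold pairAverage
  rw [inv_mul_le_iff₀ (by positivity)]
  calc ∑ k, ∑ l, ∑ x, P x * F x k l ≤ ∑ k : K, ∑ l : L, β :=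
        Finset.sum_le_sum fun k _ => Finset.sum_le_sum fun l _ => h k l
    _ = (Fintype.card K : ℝ) * Fintype.card L * β := by
        simp [mul_assoc]

/-- An independent wrong codeword passes a likelihood ratio test with threshold `γ` with
probability at most `1 / γ`. -/
theorem sum_wrong_codeword_le {A Y : Type*} [Fintype A] [Fintype Y] {q : A → ℝ}
    (hq : q ∈ stdSimplex ℝ A) {W : A → Y → ℝ} (hW : ∀ a, W a ∈ stdSimplex ℝ Y) {γ : ℝ}
    (hγ : 0 < γ) {T : A → Y → Prop} (hT : ∀ a y, T a y → γ * ∑ a', q a' * W a' y ≤ W a y) :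
    ∑ a, ∑ a', q a * q a' * ∑ y, W a y * ind (T a' y) ≤ γ⁻¹ := by
  -- The sent codeword `a` is independent of the tested `a'`; averaging over `a` first gives the
  -- output marginal that `hT` compares with `W a'`.
  have h1 : ∑ a, ∑ a', q a * q a' * ∑ y, W a y * ind (T a' y) =
      ∑ a', q a' * ∑ y, (∑ a, q a * W a y) * ind (T a' y) := by
    rw [Finset.sum_comm]
    refine Finset.sum_congr rfl fun a' _ => ?_
    simp_rw [Finset.sum_mul, Finset.mul_sum]
    rw [Finset.sum_comm]
    refine Finset.sum_congr rfl fun y _ => Finset.sum_congr rfl fun a _ => ?_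
    ring
  rw [h1]
  refine sum_mul_le_of_le hq fun a' => ?_
  have h2 : ∀ y, (∑ a, q a * W a y) * ind (T a' y) ≤ γ⁻¹ * W a' y := by
    intro y
    by_cases h : T a' y
    · rw [ind_of h, mul_one, ← div_eq_inv_mul, le_div_iff₀ hγ, mul_comm]
      exact hT a' y h
    · rw [ind_of_not h, mul_zero]
      exact mul_nonneg (inv_nonneg.mpr hγ.le) ((hW a').1 y)
  calc ∑ y, (∑ a, q a * W a y) * ind (T a' y) ≤ ∑ y, γ⁻¹ * W a' y :=
        Finset.sum_le_sum fun y _ => h2 y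
    _ = γ⁻¹ := by rw [← Finset.mul_sum, (hW a').2, mul_one]

/-- A decoder which selects some index passing a test. -/
theorem exists_test_decoder {I Y : Type*} [Nonempty I] (T : I → Y → Prop) :
    ∃ dec : Y → I, ∀ y i, dec y ≠ i → ¬T i y ∨ ∃ j, j ≠ i ∧ T j y := by
  classical
  refine ⟨fun y => if h : ∃ i, T i y then h.choose else Classical.arbitrary I, fun y i hi => ?_⟩
  by_cases h : ∃ i, T i y
  · simp only [dif_pos h] at hi
    exact Or.inr ⟨_, hi, h.choose_spec⟩
  · exact Or.inl fun h' => h ⟨i, h'⟩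

theorem card_subtype_ne {K : Type*} [Fintype K] [DecidableEq K] (k : K) :
    (Fintype.card {j // j ≠ k} : ℝ) = Fintype.card K - 1 := by
  have : 0 < Fintype.card K := Fintype.card_pos_iff.mpr ⟨k⟩
  rw [Fintype.card_subtype_compl, Fintype.card_subtype_eq, Nat.cast_sub this, Nat.cast_one]

/-- Random coding for a point-to-point channel used with side information `l` at the decoder; the
codewords of all index pairs with a common `l` are different entries of the codebook. -/
theorem sum_codebook_error_le {J A Y K L : Type*} [Fintype J] [DecidableEq J] [Fintype A]
    [Fintype Y] [Fintype K] [DecidableEq K] [Nonempty K] {q : A → ℝ} (hq : q ∈ stdSimplex ℝ A)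
    {W : A → Y → ℝ} (hW : ∀ a, W a ∈ stdSimplex ℝ Y) {γ : ℝ} (hγ : 0 < γ) {T : A → Y → Prop}
    (hT : ∀ a y, T a y → γ * ∑ a', q a' * W a' y ≤ W a y) {idx : K → L → J}
    (hidx : ∀ l, Function.Injective fun k => idx k l) :
    ∃ dec : (J → A) → Y → L → K, ∀ k l,
      ∑ c : J → A, (∏ j, q (c j)) * ∑ y, W (c (idx k l)) y * ind (dec c y l ≠ k) ≤
        ∑ a, q a * ∑ y, W a y * ind (¬T a y) + (Fintype.card K - 1) * γ⁻¹ := by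
  choose dec hdec using fun (x : (J → A) × L) =>
    exists_test_decoder (I := K) fun k y => T (x.1 (idx k x.2)) y
  refine ⟨fun c y l => dec (c, l) y, fun k l => ?_⟩
  have hPc : (fun c : J → A => ∏ j, q (c j)) ∈ stdSimplex ℝ (J → A) :=
    prod_mem_stdSimplex fun _ => hq
  have h1 : ∀ c : J → A, ∑ y, W (c (idx k l)) y * ind (dec (c, l) y ≠ k) ≤
      ∑ y, W (c (idx k l)) y * ind (¬T (c (idx k l)) y) +
        ∑ k' : {k' // k' ≠ k}, ∑ y, W (c (idx k l)) y * ind (T (c (idx k' l)) y) := by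
    intro c
    rw [Finset.sum_comm, ← Finset.sum_add_distrib]
    refine Finset.sum_le_sum fun y _ => ?_
    rw [← Finset.mul_sum, ← mul_add]
    refine mul_le_mul_of_nonneg_left ?_ ((hW _).1 y)
    refine le_trans (ind_mono fun h => ?_) ((ind_or_le (¬T (c (idx k l)) y)
      (∃ k' : {k' // k' ≠ k}, T (c (idx k' l)) y)).trans
        (add_le_add_right (ind_exists_le _) _))
    obtain h' | ⟨j, hj, hj'⟩ := hdec (c, l) y k h
    · exact Or.inl h'
    · exact Or.inr ⟨⟨j, hj⟩, hj'⟩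
  refine (Finset.sum_le_sum fun c _ => mul_le_mul_of_nonneg_left (h1 c) (hPc.1 c)).trans ?_
  simp_rw [mul_add]
  rw [Finset.sum_add_distrib]
  refine add_le_add (le_of_eq ?_) ?_
  · exact sum_prod_apply_one hq (idx k l) fun a => ∑ y, W a y * ind (¬T a y)
  · simp_rw [Finset.mul_sum (s := (Finset.univ : Finset {k' // k' ≠ k}))]
    rw [Finset.sum_comm, ← card_subtype_ne k, ← nsmul_eq_mul, ← Finset.card_univ]
    refine Finset.sum_le_card_nsmul _ _ _ fun k' _ => ?_
    -- By injectivity the wrong index points to another entry of the codebook, so the two codewords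
    -- are independent.
    rw [sum_prod_apply_two hq (fun h => k'.2 (hidx l h.symm))
      fun a a' => ∑ y, W a y * ind (T a' y)]
    exact sum_wrong_codeword_le hq hW hγ hT

/-- Random coding for the multiple access channel with a joint likelihood ratio test. -/
theorem exists_mac_code {A B Y K L : Type*} [Fintype A] [Fintype B]
    [Fintype Y] [Fintype K] [Fintype L] [Nonempty K] [Nonempty L]
    {p : A → ℝ} (hp : p ∈ stdSimplex ℝ A) {q : B → ℝ} (hq : q ∈ stdSimplex ℝ B)
    {W : A → B → Y → ℝ} (hW : ∀ a b, W a b ∈ stdSimplex ℝ Y) {γ₁ γ₂ γ₃ : ℝ}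
    (hγ₁ : 0 < γ₁) (hγ₂ : 0 < γ₂) (hγ₃ : 0 < γ₃) {T : A → B → Y → Prop}
    (hT₁ : ∀ a b y, T a b y → γ₁ * ∑ a', p a' * W a' b y ≤ W a b y)
    (hT₂ : ∀ a b y, T a b y → γ₂ * ∑ b', q b' * W a b' y ≤ W a b y)
    (hT₃ : ∀ a b y, T a b y → γ₃ * ∑ x : A × B, p x.1 * q x.2 * W x.1 x.2 y ≤ W a b y) :
    ∃ (c : K → A) (d : L → B) (dec : Y → K × L),
      (pairAverage fun k l => ∑ y, W (c k) (d l) y * ind (dec y ≠ (k, l))) ≤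
        ∑ a, p a * ∑ b, q b * ∑ y, W a b y * ind (¬T a b y) + (Fintype.card K - 1) * γ₁⁻¹ +
          (Fintype.card L - 1) * γ₂⁻¹ + (Fintype.card K - 1) * (Fintype.card L - 1) * γ₃⁻¹ := by
  classical
  choose dec hdec using fun (x : (K → A) × (L → B)) =>
    exists_test_decoder (I := K × L) fun k y => T (x.1 k.1) (x.2 k.2) y
  have hPc : (fun c : K → A => ∏ j, p (c j)) ∈ stdSimplex ℝ (K → A) :=
    prod_mem_stdSimplex fun _ => hp
  have hPd : (fun c : L → B => ∏ j, q (c j)) ∈ stdSimplex ℝ (L → B) :=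
    prod_mem_stdSimplex fun _ => hq
  suffices h : ∃ x : (K → A) × (L → B),
      (pairAverage fun k l => ∑ y, W (x.1 k) (x.2 l) y * ind (dec x y ≠ (k, l))) ≤
        ∑ a, p a * ∑ b, q b * ∑ y, W a b y * ind (¬T a b y) + (Fintype.card K - 1) * γ₁⁻¹ +
          (Fintype.card L - 1) * γ₂⁻¹ + (Fintype.card K - 1) * (Fintype.card L - 1) * γ₃⁻¹ by
    obtain ⟨x, hx⟩ := h
    exact ⟨x.1, x.2, dec x, hx⟩
  have hP := prod_mem_stdSimplex_two hPc hPd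
  refine exists_pairAverage_le hP fun k l => ?_
  let G : A → A → B → B → ℝ := fun a a' b b' => ∑ y, W a b y * ind (T a' b' y)
  -- A decoding error has four possible causes: the true pair fails the test, or a pair passes that
  -- is wrong only in `k`, only in `l`, or in both.
  have h1 : ∀ (c : K → A) (d : L → B), ∑ y, W (c k) (d l) y * ind (dec (c, d) y ≠ (k, l)) ≤
      ∑ y, W (c k) (d l) y * ind (¬T (c k) (d l) y) +
        ∑ k' : {k' // k' ≠ k}, G (c k) (c k') (d l) (d l) +
        ∑ l' : {l' // l' ≠ l}, G (c k) (c k) (d l) (d l') +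
        ∑ x : {k' // k' ≠ k} × {l' // l' ≠ l}, G (c k) (c x.1) (d l) (d x.2) := by
    intro c d
    simp only [G]
    rw [Finset.sum_comm (γ := {k' // k' ≠ k}), Finset.sum_comm (γ := {l' // l' ≠ l}),
      Finset.sum_comm (γ := {k' // k' ≠ k} × {l' // l' ≠ l}), ← Finset.sum_add_distrib,
      ← Finset.sum_add_distrib, ← Finset.sum_add_distrib]
    refine Finset.sum_le_sum fun y _ => ?_
    simp only [← Finset.mul_sum, ← mul_add]
    refine mul_le_mul_of_nonneg_left ?_ ((hW _ _).1 y)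
    refine le_trans (ind_mono (q := ((¬T (c k) (d l) y ∨
      ∃ k' : {k' // k' ≠ k}, T (c k') (d l) y) ∨ ∃ l' : {l' // l' ≠ l}, T (c k) (d l') y) ∨
      ∃ x : {k' // k' ≠ k} × {l' // l' ≠ l}, T (c x.1) (d x.2) y) fun h => ?_) ?_
    · obtain h' | ⟨⟨k', l'⟩, hj, hj'⟩ := hdec (c, d) y (k, l) h
      · exact Or.inl (Or.inl (Or.inl h'))
      · by_cases hk : k' = k
        · subst hk
          exact Or.inl (Or.inr ⟨⟨l', fun hl => hj (by rw [hl])⟩, hj'⟩)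
        · by_cases hl : l' = l
          · subst hl
            exact Or.inl (Or.inl (Or.inr ⟨⟨k', hk⟩, hj'⟩))
          · exact Or.inr ⟨(⟨k', hk⟩, ⟨l', hl⟩), hj'⟩
    · refine (ind_or_le _ _).trans (add_le_add ?_ (ind_exists_le _))
      refine (ind_or_le _ _).trans (add_le_add ?_ (ind_exists_le _))
      exact (ind_or_le _ _).trans (add_le_add le_rfl (ind_exists_le _))
  refine (Finset.sum_le_sum fun x _ => mul_le_mul_of_nonneg_left (h1 x.1 x.2) (hP.1 x)).trans ?_
  simp_rw [mul_add]
  rw [Finset.sum_add_distrib, Finset.sum_add_distrib, Finset.sum_add_distrib]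
  have hsplit : ∀ F : (K → A) → (L → B) → ℝ,
      ∑ x : (K → A) × (L → B), (∏ j, p (x.1 j)) * (∏ j, q (x.2 j)) * F x.1 x.2 =
        ∑ c : K → A, (∏ j, p (c j)) * ∑ d : L → B, (∏ j, q (d j)) * F c d := by
    intro F
    rw [Fintype.sum_prod_type]
    simp only [mul_assoc, ← Finset.mul_sum]
  refine add_le_add (add_le_add (add_le_add ?_ ?_) ?_) ?_
  · refine le_of_eq ((hsplit fun c d => ∑ y, W (c k) (d l) y * ind (¬T (c k) (d l) y)).trans ?_)
    rw [← sum_prod_apply_one hp k fun a => ∑ b, q b * ∑ y, W a b y * ind (¬T a b y)]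
    exact Finset.sum_congr rfl fun c _ => congrArg _ (sum_prod_apply_one hq l fun b =>
      ∑ y, W (c k) b y * ind (¬T (c k) b y))
  · simp_rw [Finset.mul_sum (s := (Finset.univ : Finset {k' // k' ≠ k}))]
    rw [Finset.sum_comm, ← card_subtype_ne k, ← nsmul_eq_mul, ← Finset.card_univ]
    refine Finset.sum_le_card_nsmul _ _ _ fun k' _ => ?_
    rw [hsplit fun c d => G (c k) (c k') (d l) (d l)]
    -- The true and the wrong pair share the codeword `d l`. With `d` held fixed, this is a
    -- single-user problem for the channel `W · (d l)`.
    rw [Finset.sum_congr rfl fun c _ => Finset.mul_sum _ _ _, Finset.sum_comm]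
    simp_rw [mul_left_comm (∏ j, p _), ← Finset.mul_sum]
    refine sum_mul_le_of_le hPd fun d => ?_
    rw [sum_prod_apply_two hp k'.2.symm fun a a' => G a a' (d l) (d l)]
    exact sum_wrong_codeword_le hp (fun a => hW a (d l)) hγ₁ fun a y => hT₁ a (d l) y
  · simp_rw [Finset.mul_sum (s := (Finset.univ : Finset {l' // l' ≠ l}))]
    rw [Finset.sum_comm, ← card_subtype_ne l, ← nsmul_eq_mul, ← Finset.card_univ]
    refine Finset.sum_le_card_nsmul _ _ _ fun l' _ => ?_
    rw [hsplit fun c d => G (c k) (c k) (d l) (d l')]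
    have h2 : ∀ c : K → A, ∑ d : L → B, (∏ j, q (d j)) * G (c k) (c k) (d l) (d l') =
        ∑ b, ∑ b', q b * q b' * G (c k) (c k) b b' := fun c =>
      sum_prod_apply_two hq l'.2.symm fun b b' => G (c k) (c k) b b'
    simp_rw [h2]
    exact sum_mul_le_of_le hPc fun c =>
      sum_wrong_codeword_le hq (fun b => hW (c k) b) hγ₂ fun b y => hT₂ (c k) b y
  · simp_rw [Finset.mul_sum (s := (Finset.univ : Finset ({k' // k' ≠ k} × {l' // l' ≠ l})))]
    rw [Finset.sum_comm, ← card_subtype_ne k, ← card_subtype_ne l, ← Nat.cast_mul,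
      ← Fintype.card_prod, ← nsmul_eq_mul, ← Finset.card_univ]
    refine Finset.sum_le_card_nsmul _ _ _ fun x _ => ?_
    rw [hsplit fun c d => G (c k) (c x.1) (d l) (d x.2)]
    have h2 : ∀ c : K → A, ∑ d : L → B, (∏ j, q (d j)) * G (c k) (c x.1) (d l) (d x.2) =
        ∑ b, ∑ b', q b * q b' * G (c k) (c x.1) b b' := fun c =>
      sum_prod_apply_two hq x.2.2.symm fun b b' => G (c k) (c x.1) b b'
    simp_rw [h2]
    rw [sum_prod_apply_two hp x.1.2.symm fun a a' => ∑ b, ∑ b', q b * q b' * G a a' b b']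
    -- With both indices wrong, the two pairs are independent and each acts as one input letter from
    -- `A × B`.
    refine le_trans (le_of_eq ?_) (sum_wrong_codeword_le (prod_mem_stdSimplex_two hp hq)
      (W := fun x => W x.1 x.2) (fun x => hW x.1 x.2) hγ₃ (T := fun x => T x.1 x.2)
      fun x y => hT₃ x.1 x.2 y)
    simp only [Fintype.sum_prod_type, Finset.mul_sum (s := (Finset.univ : Finset B))]
    refine Finset.sum_congr rfl fun a _ => ?_
    rw [Finset.sum_comm]
    refine Finset.sum_congr rfl fun b _ => Finset.sum_congr rfl fun a' _ =>
      Finset.sum_congr rfl fun b' _ => ?_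
    simp only [G]
    ring

/-- Random coding for the broadcast phase: each of the two receivers knows one index of the pair
`(k, l)` and decodes the other one. -/
theorem exists_broadcast_code {J A Y₁ Y₂ K L : Type*} [Finite J] [Fintype A] [Fintype Y₁]
    [Fintype Y₂] [Fintype K] [Fintype L] [Nonempty K] [Nonempty L]
    {q : A → ℝ} (hq : q ∈ stdSimplex ℝ A) {W₁ : A → Y₁ → ℝ} (hW₁ : ∀ a, W₁ a ∈ stdSimplex ℝ Y₁)
    {W₂ : A → Y₂ → ℝ} (hW₂ : ∀ a, W₂ a ∈ stdSimplex ℝ Y₂) {γ₁ γ₂ : ℝ} (hγ₁ : 0 < γ₁)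
    (hγ₂ : 0 < γ₂) {T₁ : A → Y₁ → Prop} {T₂ : A → Y₂ → Prop}
    (hT₁ : ∀ a y, T₁ a y → γ₁ * ∑ a', q a' * W₁ a' y ≤ W₁ a y)
    (hT₂ : ∀ a y, T₂ a y → γ₂ * ∑ a', q a' * W₂ a' y ≤ W₂ a y) {idx : K → L → J}
    (hidx₁ : ∀ k, Function.Injective (idx k)) (hidx₂ : ∀ l, Function.Injective fun k => idx k l) :
    ∃ (c : J → A) (dec₁ : Y₁ → K → L) (dec₂ : Y₂ → L → K),
      (pairAverage fun k l => ∑ y, W₁ (c (idx k l)) y * ind (dec₁ y k ≠ l) +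
        ∑ y, W₂ (c (idx k l)) y * ind (dec₂ y l ≠ k)) ≤
        ∑ a, q a * ∑ y, W₁ a y * ind (¬T₁ a y) + (Fintype.card L - 1) * γ₁⁻¹ +
          (∑ a, q a * ∑ y, W₂ a y * ind (¬T₂ a y) + (Fintype.card K - 1) * γ₂⁻¹) := by
  classical
  have := Fintype.ofFinite J
  -- Both receivers are analysed over the same random codebook, with message and side information
  -- exchanged, so that one realisation is good for the sum of their errors.
  obtain ⟨dec₁, h₁⟩ := sum_codebook_error_le (K := L) (L := K) hq hW₁ hγ₁ hT₁
    (idx := fun l k => idx k l) hidx₁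
  obtain ⟨dec₂, h₂⟩ := sum_codebook_error_le hq hW₂ hγ₂ hT₂ hidx₂
  have hPc : (fun c : J → A => ∏ j, q (c j)) ∈ stdSimplex ℝ (J → A) :=
    prod_mem_stdSimplex fun _ => hq
  obtain ⟨c, hc⟩ := exists_pairAverage_le hPc fun k l => (show
    ∑ c : J → A, (∏ j, q (c j)) * (∑ y, W₁ (c (idx k l)) y * ind (dec₁ c y k ≠ l) +
      ∑ y, W₂ (c (idx k l)) y * ind (dec₂ c y l ≠ k)) ≤ _ by
    simp_rw [mul_add]
    rw [Finset.sum_add_distrib]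
    exact add_le_add (h₁ l k) (h₂ k l))
  exact ⟨c, dec₁ c, dec₂ c, hc⟩

/-! ### Concentration of likelihood ratios and mutual information -/

/-- Chernoff bound for a sum of independent copies of a function `g` of negative mean. -/
theorem exists_exp_moment_lt_one {Ω : Type*} [Fintype Ω] {P : Ω → ℝ} (hP : P ∈ stdSimplex ℝ Ω)
    {g : Ω → ℝ} (hg : ∑ ω, P ω * g ω < 0) :
    ∃ s : ℝ, 0 < s ∧ ∑ ω, P ω * Real.exp (s * g ω) < 1 := by
  -- The moment generating function equals one at `0` and has the mean of `g` as its derivative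
  -- there, so it drops below one for some `s > 0`.
  let F : ℝ → ℝ := fun s => ∑ ω, P ω * Real.exp (s * g ω)
  have hF : HasDerivAt F (∑ ω, P ω * g ω) 0 := by
    have : HasDerivAt F (∑ ω, P ω * (Real.exp (0 * g ω) * (1 * g ω))) 0 :=
      HasDerivAt.fun_sum fun ω _ => (((hasDerivAt_id (0 : ℝ)).mul_const (g ω)).exp).const_mul _
    simpa using this
  have hF0 : F 0 = 1 := by simp [F, hP.2]
  have h1 := hF.tendsto_slope
  have h2 : ∀ᶠ s in nhdsWithin (0 : ℝ) (Set.Ioi 0), slope F 0 s < 0 :=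
    (h1.mono_left (nhdsWithin_mono _ fun s hs => ne_of_gt hs)).eventually_lt_const hg
  obtain ⟨s, hs, hs0⟩ := (h2.and self_mem_nhdsWithin).exists
  refine ⟨s, hs0, ?_⟩
  have hs0' : (0 : ℝ) < s := hs0
  rw [slope_def_field, hF0, sub_zero, div_neg_iff] at hs
  have : F s < 1 := by rcases hs with h | h <;> linarith [h.1, h.2]
  exact this

/-- A likelihood ratio of product form is unlikely to be exponentially smaller than predicted by
its mean logarithm. -/
theorem exists_likelihood_ratio_bound {Ω : Type*} [Fintype Ω] {P W V : Ω → ℝ}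
    (hP : P ∈ stdSimplex ℝ Ω) (hW : ∀ ω, 0 < P ω → 0 < W ω) (hV : ∀ ω, 0 < P ω → 0 < V ω) {R : ℝ}
    (hR : R < ∑ ω, P ω * Real.logb 2 (W ω / V ω)) :
    ∃ ρ : ℝ, 0 ≤ ρ ∧ ρ < 1 ∧ ∀ n : ℕ, ∑ ω : Fin n → Ω, (∏ i, P (ω i)) *
      ind (¬((2 : ℝ) ^ (n * R) * ∏ i, V (ω i) ≤ ∏ i, W (ω i))) ≤ ρ ^ n := by
  -- The shortfall of the log-likelihood ratio from `R`, converted to nats; `hR` makes its mean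
  -- negative.
  let g : Ω → ℝ := fun ω => (R - Real.logb 2 (W ω / V ω)) * Real.log 2
  have hl2 : 0 < Real.log 2 := Real.log_pos one_lt_two
  have hg : ∑ ω, P ω * g ω < 0 := by
    have : ∑ ω, P ω * g ω = (R - ∑ ω, P ω * Real.logb 2 (W ω / V ω)) * Real.log 2 := by
      simp only [g, ← mul_assoc, ← Finset.sum_mul, mul_sub, Finset.sum_sub_distrib, hP.2, one_mul]
    rw [this]
    exact mul_neg_of_neg_of_pos (by linarith) hl2
  obtain ⟨s, hs, hs1⟩ := exists_exp_moment_lt_one hP hg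
  refine ⟨_, sum_mul_nonneg hP fun ω => (Real.exp_pos _).le, hs1, fun n => ?_⟩
  have hpow : (∑ ω, P ω * Real.exp (s * g ω)) ^ n =
      ∑ ω : Fin n → Ω, ∏ i, (P (ω i) * Real.exp (s * g (ω i))) := by
    rw [sum_prod_apply fun (_ : Fin n) ω => P ω * Real.exp (s * g ω)]
    simp
  rw [hpow]
  refine Finset.sum_le_sum fun ω _ => ?_
  rw [Finset.prod_mul_distrib]
  -- Sequences of probability zero contribute nothing; on the others `hW` and `hV` make all
  -- logarithms legitimate.
  by_cases h0 : ∏ i, P (ω i) = 0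
  · simp [h0]
  refine mul_le_mul_of_nonneg_left ?_ (Finset.prod_nonneg fun i _ => hP.1 _)
  have hPi : ∀ i, 0 < P (ω i) := fun i =>
    lt_of_le_of_ne (hP.1 _) fun h => h0 (Finset.prod_eq_zero (Finset.mem_univ i) h.symm)
  by_cases ht : (2 : ℝ) ^ (n * R) * ∏ i, V (ω i) ≤ ∏ i, W (ω i)
  · rw [ind_of_not (not_not.mpr ht)]
    exact Finset.prod_nonneg fun i _ => (Real.exp_pos _).le
  -- Markov's inequality pointwise: failure of the test means that the shortfalls have nonnegative
  -- sum, so the exponential dominates the indicator.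
  · rw [ind_of ht, ← Real.exp_sum, Real.one_le_exp_iff, ← Finset.mul_sum]
    refine mul_nonneg hs.le ?_
    have h1 : ∑ i, g (ω i) = n * R * Real.log 2 + ∑ i, Real.log (V (ω i)) -
        ∑ i, Real.log (W (ω i)) := by
      have : ∀ i, g (ω i) = R * Real.log 2 + Real.log (V (ω i)) - Real.log (W (ω i)) := by
        intro i
        simp only [g, Real.logb]
        rw [sub_mul, div_mul_cancel₀ _ hl2.ne',
          Real.log_div (hW _ (hPi i)).ne' (hV _ (hPi i)).ne']
        ring
      simp only [this, Finset.sum_sub_distrib, Finset.sum_add_distrib, Finset.sum_const,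
        Finset.card_univ, Fintype.card_fin, nsmul_eq_mul]
      ring
    rw [h1, ← Real.log_prod fun i _ => (hV _ (hPi i)).ne',
      ← Real.log_prod fun i _ => (hW _ (hPi i)).ne', ← Real.log_rpow two_pos,
      ← Real.log_mul (by positivity) (Finset.prod_pos fun i _ => hV _ (hPi i)).ne', sub_nonneg]
    exact Real.log_le_log (Finset.prod_pos fun i _ => hW _ (hPi i)) (not_le.mp ht).le

/-- The mutual information between the input and the output of a channel. -/
theorem mutualInfo_channel {A Y : Type*} [Fintype A] [Fintype Y] {q : A → ℝ} {W : A → Y → ℝ}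
    (hW : ∀ a, W a ∈ stdSimplex ℝ Y) :
    mutualInfo (fun a y => q a * W a y) =
      ∑ x : A × Y, q x.1 * W x.1 x.2 * Real.logb 2 (W x.1 x.2 / ∑ a', q a' * W a' x.2) := by
  rw [Fintype.sum_prod_type]
  refine Finset.sum_congr rfl fun a _ => Finset.sum_congr rfl fun y _ => ?_
  by_cases hq : q a = 0
  · simp [hq]
  rw [← Finset.mul_sum, (hW a).2, mul_one, mul_div_mul_left _ _ hq]

/-- The conditional mutual information between the first input and the output of a multiple access
channel given the second input. -/
theorem condMutualInfo_channel {A B Y : Type*} [Fintype A] [Fintype B] [Fintype Y] {p : A → ℝ}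
    (hp : p ∈ stdSimplex ℝ A) {q : B → ℝ} {W : A → B → Y → ℝ}
    (hW : ∀ a b, W a b ∈ stdSimplex ℝ Y) :
    condMutualInfo (fun a y b => p a * q b * W a b y) =
      ∑ x : A × B × Y, p x.1 * q x.2.1 * W x.1 x.2.1 x.2.2 *
        Real.logb 2 (W x.1 x.2.1 x.2.2 / ∑ a', p a' * W a' x.2.1 x.2.2) := by
  simp_rw [Fintype.sum_prod_type]
  refine Finset.sum_congr rfl fun a _ => ?_
  rw [Finset.sum_comm]
  refine Finset.sum_congr rfl fun b _ => Finset.sum_congr rfl fun y _ => ?_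
  by_cases hpa : p a = 0
  · simp [hpa]
  by_cases hqb : q b = 0
  · simp [hqb]
  have h1 : ∑ a', ∑ y', p a' * q b * W a' b y' = q b := by
    simp_rw [← Finset.mul_sum, (hW _ b).2, mul_one, ← Finset.sum_mul, hp.2, one_mul]
  have h2 : ∑ y', p a * q b * W a b y' = p a * q b := by
    rw [← Finset.mul_sum, (hW a b).2, mul_one]
  have h3 : ∑ a', p a' * q b * W a' b y = q b * ∑ a', p a' * W a' b y := by
    rw [Finset.mul_sum]
    exact Finset.sum_congr rfl fun a' _ => by ring
  rw [h1, h2, h3]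
  congr 2
  rw [show p a * q b * W a b y * q b = (p a * q b * q b) * W a b y by ring,
    show p a * q b * (q b * ∑ a', p a' * W a' b y) = (p a * q b * q b) * ∑ a', p a' * W a' b y by
      ring, mul_div_mul_left _ _ (by positivity)]

/-! ### Block codes from single-letter laws -/

section NLetter

variable {A B Y Y₁ Y₂ : Type*} [Fintype A] [Fintype B] [Fintype Y] [Fintype Y₁] [Fintype Y₂]

theorem sum_arrow_prod {n : ℕ} (F : (Fin n → A × B) → ℝ) :
    ∑ ω, F ω = ∑ a : Fin n → A, ∑ b : Fin n → B, F fun i => (a i, b i) := by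
  rw [← Fintype.sum_prod_type' fun (a : Fin n → A) (b : Fin n → B) => F fun i => (a i, b i)]
  exact Fintype.sum_equiv (Equiv.arrowProdEquivProdArrow _ _ _) _ _ fun _ => rfl

theorem sum_mul_pos_of_pos {p : A → ℝ} (hp : p ∈ stdSimplex ℝ A) {f : A → ℝ} (hf : ∀ a, 0 ≤ f a)
    {a : A} (h : 0 < p a * f a) : 0 < ∑ a', p a' * f a' :=
  h.trans_le (Finset.single_le_sum (f := fun a' => p a' * f a')
    (fun a' _ => mul_nonneg (hp.1 a') (hf a')) (Finset.mem_univ a))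

theorem channel_law_mem {q : A → ℝ} (hq : q ∈ stdSimplex ℝ A) {W : A → Y → ℝ}
    (hW : ∀ a, W a ∈ stdSimplex ℝ Y) :
    (fun x : A × Y => q x.1 * W x.1 x.2) ∈ stdSimplex ℝ (A × Y) := by
  refine ⟨fun x => mul_nonneg (hq.1 _) ((hW _).1 _), ?_⟩
  rw [Fintype.sum_prod_type]
  simp only [← Finset.mul_sum, (hW _).2, mul_one, hq.2]

/-- Tail bound of the likelihood ratio test for `n` uses of a channel. -/
theorem exists_channel_test_bound {q : A → ℝ} (hq : q ∈ stdSimplex ℝ A) {W : A → Y → ℝ}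
    (hW : ∀ a, W a ∈ stdSimplex ℝ Y) {τ : ℝ}
    (hτ : τ < ∑ x : A × Y, q x.1 * W x.1 x.2 *
      Real.logb 2 (W x.1 x.2 / ∑ a', q a' * W a' x.2)) :
    ∃ ρ : ℝ, 0 ≤ ρ ∧ ρ < 1 ∧ ∀ n : ℕ, ∑ a : Fin n → A, (∏ i, q (a i)) * ∑ y : Fin n → Y,
      (∏ i, W (a i) (y i)) * ind (¬((2 : ℝ) ^ (n * τ) * ∏ i, ∑ a', q a' * W a' (y i) ≤
        ∏ i, W (a i) (y i))) ≤ ρ ^ n := by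
  obtain ⟨ρ, h0, h1, h⟩ := exists_likelihood_ratio_bound (channel_law_mem hq hW)
    (W := fun x => W x.1 x.2) (V := fun x => ∑ a', q a' * W a' x.2)
    (fun x hx => pos_of_mul_pos_right hx (hq.1 _))
    (fun x hx => sum_mul_pos_of_pos hq (fun a => (hW a).1 _) hx) hτ
  refine ⟨ρ, h0, h1, fun n => le_trans (le_of_eq ?_) (h n)⟩
  rw [sum_arrow_prod]
  refine Finset.sum_congr rfl fun a _ => ?_
  rw [Finset.mul_sum]
  refine Finset.sum_congr rfl fun y _ => ?_
  rw [Finset.prod_mul_distrib, mul_assoc]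

theorem sum_prod_mul_prod {X Z : Type*} [Fintype X] {n : ℕ} (q : X → ℝ) (W : X → Z → ℝ)
    (y : Fin n → Z) : ∑ a : Fin n → X, (∏ i, q (a i)) * ∏ i, W (a i) (y i) = ∏ i, ∑ a, q a * W a (y i) := by
  rw [← sum_prod_apply fun i a => q a * W a (y i)]
  simp only [Finset.prod_mul_distrib]

/-- Broadcast codes of block length `n` for rates below the two mutual informations. -/
theorem exists_broadcast_block_code {q : A → ℝ} (hq : q ∈ stdSimplex ℝ A)
    {W₁ : A → Y₁ → ℝ} (hW₁ : ∀ a, W₁ a ∈ stdSimplex ℝ Y₁) {W₂ : A → Y₂ → ℝ}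
    (hW₂ : ∀ a, W₂ a ∈ stdSimplex ℝ Y₂) {τ₁ τ₂ : ℝ}
    (hτ₁ : τ₁ < mutualInfo fun a y => q a * W₁ a y)
    (hτ₂ : τ₂ < mutualInfo fun a y => q a * W₂ a y) :
    ∃ δ : ℕ → ℝ, Filter.Tendsto δ Filter.atTop (nhds 0) ∧
      ∀ (n : ℕ) {J K L : Type} [Finite J] [Fintype K] [Fintype L] [Nonempty K] [Nonempty L]
        (idx : K → L → J), (∀ k, Function.Injective (idx k)) →
        (∀ l, Function.Injective fun k => idx k l) →
        ∃ (c : J → Fin n → A) (dec₁ : (Fin n → Y₁) → K → L) (dec₂ : (Fin n → Y₂) → L → K),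
          (pairAverage fun k l =>
            ∑ y : Fin n → Y₁, (∏ i, W₁ (c (idx k l) i) (y i)) * ind (dec₁ y k ≠ l) +
            ∑ y : Fin n → Y₂, (∏ i, W₂ (c (idx k l) i) (y i)) * ind (dec₂ y l ≠ k)) ≤
          δ n + (Fintype.card L - 1) * ((2 : ℝ) ^ (n * τ₁))⁻¹ +
            (Fintype.card K - 1) * ((2 : ℝ) ^ (n * τ₂))⁻¹ := by
  rw [mutualInfo_channel hW₁] at hτ₁
  rw [mutualInfo_channel hW₂] at hτ₂
  obtain ⟨ρ₁, h0₁, h1₁, h₁⟩ := exists_channel_test_bound hq hW₁ hτ₁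
  obtain ⟨ρ₂, h0₂, h1₂, h₂⟩ := exists_channel_test_bound hq hW₂ hτ₂
  refine ⟨fun n => ρ₁ ^ n + ρ₂ ^ n, ?_, fun n J K L _ _ _ _ _ idx hidx₁ hidx₂ => ?_⟩
  · simpa using (tendsto_pow_atTop_nhds_zero_of_lt_one h0₁ h1₁).add (tendsto_pow_atTop_nhds_zero_of_lt_one h0₂ h1₂)
  obtain ⟨c, dec₁, dec₂, h⟩ := exists_broadcast_code (A := Fin n → A) (Y₁ := Fin n → Y₁)
    (Y₂ := Fin n → Y₂) (prod_mem_stdSimplex fun _ => hq)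
    (W₁ := fun a y => ∏ i, W₁ (a i) (y i)) (fun a => prod_mem_stdSimplex fun i => hW₁ (a i))
    (W₂ := fun a y => ∏ i, W₂ (a i) (y i)) (fun a => prod_mem_stdSimplex fun i => hW₂ (a i))
    (γ₁ := (2 : ℝ) ^ (n * τ₁)) (γ₂ := (2 : ℝ) ^ (n * τ₂)) (by positivity) (by positivity)
    (T₁ := fun a y => (2 : ℝ) ^ (n * τ₁) * ∏ i, ∑ a', q a' * W₁ a' (y i) ≤ ∏ i, W₁ (a i) (y i))
    (T₂ := fun a y => (2 : ℝ) ^ (n * τ₂) * ∏ i, ∑ a', q a' * W₂ a' (y i) ≤ ∏ i, W₂ (a i) (y i))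
    (fun a y hT => by rw [sum_prod_mul_prod]; exact hT)
    (fun a y hT => by rw [sum_prod_mul_prod]; exact hT) hidx₁ hidx₂
  refine ⟨c, dec₁, dec₂, h.trans ?_⟩
  linarith [h₁ n, h₂ n]

/-- Multiple access codes of block length `n` for rates in the interior of the rate region. -/
theorem exists_mac_block_code {p : A → ℝ} (hp : p ∈ stdSimplex ℝ A) {q : B → ℝ}
    (hq : q ∈ stdSimplex ℝ B) {W : A → B → Y → ℝ} (hW : ∀ a b, W a b ∈ stdSimplex ℝ Y)
    {τ₁ τ₂ τ₃ : ℝ} (hτ₁ : τ₁ < condMutualInfo fun a y b => p a * q b * W a b y)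
    (hτ₂ : τ₂ < condMutualInfo fun b y a => p a * q b * W a b y)
    (hτ₃ : τ₃ < mutualInfo fun (x : A × B) y => p x.1 * q x.2 * W x.1 x.2 y) :
    ∃ δ : ℕ → ℝ, Filter.Tendsto δ Filter.atTop (nhds 0) ∧
      ∀ (n : ℕ) {K L : Type} [Fintype K] [Fintype L] [Nonempty K] [Nonempty L],
        ∃ (c : K → Fin n → A) (d : L → Fin n → B) (dec : (Fin n → Y) → K × L),
          (pairAverage fun k l =>
            ∑ y : Fin n → Y, (∏ i, W (c k i) (d l i) (y i)) * ind (dec y ≠ (k, l))) ≤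
          δ n + (Fintype.card K - 1) * ((2 : ℝ) ^ (n * τ₁))⁻¹ +
            (Fintype.card L - 1) * ((2 : ℝ) ^ (n * τ₂))⁻¹ +
            (Fintype.card K - 1) * (Fintype.card L - 1) * ((2 : ℝ) ^ (n * τ₃))⁻¹ := by
  rw [condMutualInfo_channel hp hW] at hτ₁
  -- Puts the second user's law first, so that `condMutualInfo_channel` applies with the users
  -- exchanged.
  simp_rw [mul_comm (p _) (q _)] at hτ₂
  rw [condMutualInfo_channel hq (W := fun b a y => W a b y) fun b a => hW a b] at hτ₂
  rw [mutualInfo_channel (q := fun x : A × B => p x.1 * q x.2) (W := fun x y => W x.1 x.2 y)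
    fun x => hW x.1 x.2] at hτ₃
  have hpq := prod_mem_stdSimplex_two hp hq
  have hτ₁' : τ₁ < ∑ x : (A × B) × Y, p x.1.1 * q x.1.2 * W x.1.1 x.1.2 x.2 *
      Real.logb 2 (W x.1.1 x.1.2 x.2 / ∑ a', p a' * W a' x.1.2 x.2) := by
    simpa only [Fintype.sum_prod_type] using hτ₁
  have hτ₂' : τ₂ < ∑ x : (A × B) × Y, p x.1.1 * q x.1.2 * W x.1.1 x.1.2 x.2 *
      Real.logb 2 (W x.1.1 x.1.2 x.2 / ∑ b', q b' * W x.1.1 b' x.2) := by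
    simp only [Fintype.sum_prod_type] at hτ₂ ⊢
    rw [Finset.sum_comm] at hτ₂
    simpa only [mul_comm (p _) (q _)] using hτ₂
  have hP := channel_law_mem hpq (W := fun x y => W x.1 x.2 y) fun x => hW x.1 x.2
  have hWpos : ∀ x : (A × B) × Y, 0 < p x.1.1 * q x.1.2 * W x.1.1 x.1.2 x.2 →
      0 < W x.1.1 x.1.2 x.2 := fun x hx =>
    pos_of_mul_pos_right hx (mul_nonneg (hp.1 _) (hq.1 _))
  obtain ⟨ρ₁, h0₁, h1₁, h₁⟩ := exists_likelihood_ratio_bound hP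
    (W := fun x => W x.1.1 x.1.2 x.2) (V := fun x => ∑ a', p a' * W a' x.1.2 x.2) hWpos
    (fun x hx => sum_mul_pos_of_pos hp (fun a => (hW a _).1 _) (a := x.1.1) (mul_pos
      (lt_of_le_of_ne (hp.1 _) fun h => by simp [← h] at hx) (hWpos x hx))) hτ₁'
  obtain ⟨ρ₂, h0₂, h1₂, h₂⟩ := exists_likelihood_ratio_bound hP
    (W := fun x => W x.1.1 x.1.2 x.2) (V := fun x => ∑ b', q b' * W x.1.1 b' x.2) hWpos
    (fun x hx => sum_mul_pos_of_pos hq (fun b => (hW _ b).1 _) (a := x.1.2) (mul_pos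
      (lt_of_le_of_ne (hq.1 _) fun h => by simp [← h] at hx) (hWpos x hx))) hτ₂'
  obtain ⟨ρ₃, h0₃, h1₃, h₃⟩ := exists_likelihood_ratio_bound hP
    (W := fun x => W x.1.1 x.1.2 x.2)
    (V := fun x => ∑ z : A × B, p z.1 * q z.2 * W z.1 z.2 x.2) hWpos
    (fun x hx => sum_mul_pos_of_pos hpq (fun z => (hW z.1 z.2).1 _) hx) hτ₃
  refine ⟨fun n => ρ₁ ^ n + ρ₂ ^ n + ρ₃ ^ n, ?_, fun n K L _ _ _ _ => ?_⟩
  · simpa using ((tendsto_pow_atTop_nhds_zero_of_lt_one h0₁ h1₁).add (tendsto_pow_atTop_nhds_zero_of_lt_one h0₂ h1₂)).add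
      (tendsto_pow_atTop_nhds_zero_of_lt_one h0₃ h1₃)
  -- One test per type of wrong pair; the reference law averages over exactly those inputs that are
  -- wrong.
  let T₁ : (Fin n → A) → (Fin n → B) → (Fin n → Y) → Prop := fun a b y =>
    (2 : ℝ) ^ (n * τ₁) * ∏ i, ∑ a', p a' * W a' (b i) (y i) ≤ ∏ i, W (a i) (b i) (y i)
  let T₂ : (Fin n → A) → (Fin n → B) → (Fin n → Y) → Prop := fun a b y =>
    (2 : ℝ) ^ (n * τ₂) * ∏ i, ∑ b', q b' * W (a i) b' (y i) ≤ ∏ i, W (a i) (b i) (y i)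
  let T₃ : (Fin n → A) → (Fin n → B) → (Fin n → Y) → Prop := fun a b y =>
    (2 : ℝ) ^ (n * τ₃) * ∏ i, ∑ z : A × B, p z.1 * q z.2 * W z.1 z.2 (y i) ≤
      ∏ i, W (a i) (b i) (y i)
  obtain ⟨c, d, dec, h⟩ := exists_mac_code (A := Fin n → A) (B := Fin n → B) (K := K) (L := L)
    (prod_mem_stdSimplex fun _ => hp) (prod_mem_stdSimplex fun _ => hq)
    (W := fun a b y => ∏ i, W (a i) (b i) (y i))
    (fun a b => prod_mem_stdSimplex fun i => hW (a i) (b i))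
    (γ₁ := (2 : ℝ) ^ (n * τ₁)) (γ₂ := (2 : ℝ) ^ (n * τ₂)) (γ₃ := (2 : ℝ) ^ (n * τ₃))
    (by positivity) (by positivity) (by positivity)
    (T := fun a b y => T₁ a b y ∧ T₂ a b y ∧ T₃ a b y)
    (fun a b y hT => by
      refine le_trans (le_of_eq ?_) hT.1
      rw [← sum_prod_apply fun i a' => p a' * W a' (b i) (y i)]
      simp only [Finset.prod_mul_distrib])
    (fun a b y hT => by
      refine le_trans (le_of_eq ?_) hT.2.1
      rw [← sum_prod_apply fun i b' => q b' * W (a i) b' (y i)]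
      simp only [Finset.prod_mul_distrib])
    (fun a b y hT => by
      refine le_trans (le_of_eq ?_) hT.2.2
      rw [← sum_prod_apply fun i (z : A × B) => p z.1 * q z.2 * W z.1 z.2 (y i),
        sum_arrow_prod, Fintype.sum_prod_type]
      simp only [Finset.prod_mul_distrib])
  refine ⟨c, d, dec, h.trans ?_⟩
  have hT : ∀ a b y, ind (¬(T₁ a b y ∧ T₂ a b y ∧ T₃ a b y)) ≤
      ind (¬T₁ a b y) + ind (¬T₂ a b y) + ind (¬T₃ a b y) := by
    intro a b y
    refine (ind_mono (q := (¬T₁ a b y ∨ ¬T₂ a b y) ∨ ¬T₃ a b y) fun h => by tauto).trans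
      ((ind_or_le _ _).trans (add_le_add (ind_or_le _ _) le_rfl))
  have hsum : ∑ a : Fin n → A, (∏ i, p (a i)) * ∑ b : Fin n → B, (∏ i, q (b i)) *
      ∑ y : Fin n → Y, (∏ i, W (a i) (b i) (y i)) * ind (¬(T₁ a b y ∧ T₂ a b y ∧ T₃ a b y)) ≤
      ρ₁ ^ n + ρ₂ ^ n + ρ₃ ^ n := by
    refine le_trans ?_ (add_le_add (add_le_add (h₁ n) (h₂ n)) (h₃ n))
    rw [← Finset.sum_add_distrib, ← Finset.sum_add_distrib, sum_arrow_prod, sum_arrow_prod]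
    refine Finset.sum_le_sum fun a _ => ?_
    rw [Finset.mul_sum]
    refine Finset.sum_le_sum fun b _ => ?_
    rw [Finset.mul_sum, Finset.mul_sum]
    refine Finset.sum_le_sum fun y _ => ?_
    simp only [Finset.prod_mul_distrib]
    rw [← mul_add, ← mul_add, ← mul_assoc, ← mul_assoc]
    exact mul_le_mul_of_nonneg_left (hT a b y) (mul_nonneg (mul_nonneg
      (Finset.prod_nonneg fun i _ => hp.1 _) (Finset.prod_nonneg fun i _ => hq.1 _))
      (Finset.prod_nonneg fun i _ => (hW _ _).1 _))
  linarith [hsum]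

end NLetter

/-! ### Decodability of the relay index -/

theorem eq_of_div_eq_of_add_mod_eq {M a b c : ℕ} (hd : a / M = b / M)
    (hm : (a + c) % M = (b + c) % M) : a = b := by
  have h : a % M = b % M := Nat.ModEq.add_right_cancel' c hm
  rw [← Nat.div_add_mod a M, ← Nat.div_add_mod b M, hd, h]

/-- Given `k`, the modular sum reveals the residue of `l`. If `M21` is the modulus, the residue is
`l` itself; otherwise the high part supplies the quotient. -/
theorem relayIndex_injective_snd {M12 M21 : ℕ} (k : Fin M12) :
    Function.Injective fun l : Fin M21 => relayIndex (k, l) := by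
  intro l l' h
  simp only [relayIndex] at h
  split_ifs at h with hM
  · have h2 : l.val % M21 = l'.val % M21 :=
      Nat.ModEq.add_left_cancel' k.val (congrArg Prod.snd h)
    rw [Nat.mod_eq_of_lt l.isLt, Nat.mod_eq_of_lt l'.isLt] at h2
    exact Fin.ext h2
  · have h2 := congrArg Prod.snd h
    simp only [add_comm k.val] at h2
    exact Fin.ext (eq_of_div_eq_of_add_mod_eq (congrArg Prod.fst h) h2)

theorem relayIndex_injective_fst {M12 M21 : ℕ} (l : Fin M21) :
    Function.Injective fun k : Fin M12 => relayIndex (k, l) := by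
  intro k k' h
  simp only [relayIndex] at h
  split_ifs at h with hM
  · exact Fin.ext (eq_of_div_eq_of_add_mod_eq (congrArg Prod.fst h) (congrArg Prod.snd h))
  · have h2 : k.val % M12 = k'.val % M12 :=
      Nat.ModEq.add_right_cancel' l.val (congrArg Prod.snd h)
    rw [Nat.mod_eq_of_lt k.isLt, Nat.mod_eq_of_lt k'.isLt] at h2
    exact Fin.ext h2

/-! ### Message counts against thresholds -/

/-- The number of messages per block of length `n` at rate `r`. -/
def numMessages (r : ℝ) (n : ℕ) : ℕ := ⌈(2 : ℝ) ^ (n * r)⌉₊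

instance (r : ℝ) (n : ℕ) : NeZero (numMessages r n) :=
  ⟨(Nat.ceil_pos.mpr (by positivity)).ne'⟩

theorem le_numMessages (r : ℝ) (n : ℕ) : (2 : ℝ) ^ (n * r) ≤ numMessages r n := Nat.le_ceil _

/-- The union bounds count only wrong messages, so the rounding up in `numMessages` costs nothing.
-/
theorem numMessages_sub_one_le (r : ℝ) (n : ℕ) :
    (numMessages r n : ℝ) - 1 ≤ (2 : ℝ) ^ (n * r) := by
  have := Nat.ceil_lt_add_one (a := (2 : ℝ) ^ (n * r)) (by positivity)
  unfold numMessages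
  linarith

theorem numMessages_zero (n : ℕ) : numMessages 0 n = 1 := by simp [numMessages]

theorem numMessages_sub_one_nonneg (r : ℝ) (n : ℕ) : 0 ≤ (numMessages r n : ℝ) - 1 := by
  have : 1 ≤ numMessages r n := NeZero.one_le
  have : (1 : ℝ) ≤ numMessages r n := by exact_mod_cast this
  linarith

theorem tendsto_mul_inv_two_rpow {u : ℕ → ℝ} {r τ : ℝ} (h0 : ∀ n, 0 ≤ u n)
    (hu : ∀ n : ℕ, u n ≤ (2 : ℝ) ^ (n * r)) (hr : r < τ) :
    Filter.Tendsto (fun n : ℕ => u n * ((2 : ℝ) ^ (n * τ))⁻¹) Filter.atTop (nhds 0) := by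
  have h1 : (2 : ℝ) ^ (r - τ) < 1 := Real.rpow_lt_one_of_one_lt_of_neg one_lt_two (by linarith)
  refine squeeze_zero (fun n => mul_nonneg (h0 n) (by positivity)) (fun n => ?_)
    (tendsto_pow_atTop_nhds_zero_of_lt_one (by positivity) h1)
  calc u n * ((2 : ℝ) ^ (n * τ))⁻¹ ≤ (2 : ℝ) ^ (n * r) * ((2 : ℝ) ^ (n * τ))⁻¹ :=
        mul_le_mul_of_nonneg_right (hu n) (by positivity)
    _ = ((2 : ℝ) ^ (r - τ)) ^ n := by
        rw [← Real.rpow_neg two_pos.le, ← Real.rpow_add two_pos, ← Real.rpow_natCast,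
          ← Real.rpow_mul two_pos.le]
        congr 1
        ring

/-- At rate zero there is no wrong message, so the term vanishes for every `τ`, even a negative one.
This is what admits constraints whose mutual information is zero. -/
theorem tendsto_numMessages {r τ : ℝ} (h : r = 0 ∨ r < τ) :
    Filter.Tendsto (fun n : ℕ => ((numMessages r n : ℝ) - 1) * ((2 : ℝ) ^ (n * τ))⁻¹)
      Filter.atTop (nhds 0) := by
  obtain rfl | h := h
  · simp [numMessages_zero]
  · exact tendsto_mul_inv_two_rpow (numMessages_sub_one_nonneg r) (numMessages_sub_one_le r) h

theorem tendsto_numMessages_mul {r r' τ : ℝ} (h : r = 0 ∨ r' = 0 ∨ r + r' < τ) :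
    Filter.Tendsto (fun n : ℕ => ((numMessages r n : ℝ) - 1) * ((numMessages r' n : ℝ) - 1) *
      ((2 : ℝ) ^ (n * τ))⁻¹) Filter.atTop (nhds 0) := by
  obtain rfl | rfl | h := h
  · simp [numMessages_zero]
  · simp [numMessages_zero]
  · refine tendsto_mul_inv_two_rpow (fun n => mul_nonneg (numMessages_sub_one_nonneg r n)
      (numMessages_sub_one_nonneg r' n)) (fun n => ?_) h
    rw [mul_add, Real.rpow_add two_pos]
    exact mul_le_mul (numMessages_sub_one_le r n) (numMessages_sub_one_le r' n)
      (numMessages_sub_one_nonneg r' n) (by positivity)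

theorem exists_threshold {r I : ℝ} (h : r = 0 ∨ r < I) : ∃ τ < I, r = 0 ∨ r < τ := by
  obtain h | h := h
  · exact ⟨I - 1, by linarith, Or.inl h⟩
  · obtain ⟨τ, h1, h2⟩ := exists_between h
    exact ⟨τ, h2, Or.inr h1⟩

theorem pairAverage_mono {K L : Type*} [Fintype K] [Fintype L] {e f : K → L → ℝ}
    (h : ∀ k l, e k l ≤ f k l) : pairAverage e ≤ pairAverage f :=
  mul_le_mul_of_nonneg_left (Finset.sum_le_sum fun k _ => Finset.sum_le_sum fun l _ => h k l)
    (by positivity)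

theorem pairAverage_add {K L : Type*} [Fintype K] [Fintype L] (e f : K → L → ℝ) :
    (pairAverage fun k l => e k l + f k l) = pairAverage e + pairAverage f := by
  simp only [pairAverage, Finset.sum_add_distrib, mul_add]

/-! ### Assembly of the scheme and choice of parameters -/

variable {X12 X21 XR YR Y1 Y2 : Type*}
  [Fintype X12] [Fintype X21] [Fintype XR] [Fintype YR] [Fintype Y1] [Fintype Y2]

/-- Decode-and-forward schemes with vanishing block error probabilities. -/
theorem exists_scheme (ch : Channel X12 X21 XR YR Y1 Y2) (p12 : PMF X12) (p21 : PMF X21)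
    (pR : PMF XR) {r12 r21 : ℝ}
    (h12 : r12 = 0 ∨ r12 < condMutualInfo fun x12 y x21 => upLaw ch p12 p21 x12 x21 y)
    (h12' : r12 = 0 ∨ r12 < mutualInfo (downLaw2 ch pR))
    (h21 : r21 = 0 ∨ r21 < condMutualInfo fun x21 y x12 => upLaw ch p12 p21 x12 x21 y)
    (h21' : r21 = 0 ∨ r21 < mutualInfo (downLaw1 ch pR))
    (hs : r12 = 0 ∨ r21 = 0 ∨
      r12 + r21 < mutualInfo fun (x : X12 × X21) y => upLaw ch p12 p21 x.1 x.2 y) :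
    ∃ δ : ℕ → ℝ, Filter.Tendsto δ Filter.atTop (nhds 0) ∧ ∀ n : ℕ,
      ∃ s : DFScheme X12 X21 XR YR Y1 Y2 n (numMessages r12 n) (numMessages r21 n),
        pairAverage (s.relayBlockError ch) ≤ δ n ∧
        (pairAverage fun m m' => s.relayBlockError ch m m' + s.blockError1 ch m m') ≤ δ n ∧
        (pairAverage fun m m' => s.relayBlockError ch m m' + s.blockError2 ch m m') ≤ δ n := by
  obtain ⟨τ₁, hτ₁, hr₁⟩ := exists_threshold h12
  obtain ⟨τ₂, hτ₂, hr₂⟩ := exists_threshold h21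
  obtain ⟨τ₃, hτ₃, hr₃⟩ : ∃ τ < mutualInfo fun (x : X12 × X21) y => upLaw ch p12 p21 x.1 x.2 y,
      r12 = 0 ∨ r21 = 0 ∨ r12 + r21 < τ := by
    obtain h | h | h := hs
    · exact ⟨_, sub_one_lt _, Or.inl h⟩
    · exact ⟨_, sub_one_lt _, Or.inr (Or.inl h)⟩
    · obtain ⟨τ, h1, h2⟩ := exists_between h
      exact ⟨τ, h2, Or.inr (Or.inr h1)⟩
  obtain ⟨σ₁, hσ₁, hs₁⟩ := exists_threshold h21'
  obtain ⟨σ₂, hσ₂, hs₂⟩ := exists_threshold h12'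
  obtain ⟨δ, hδ, hmac⟩ := exists_mac_block_code (pmf_toReal_mem p12) (pmf_toReal_mem p21)
    (W := fun a b y => (ch.up a b y).toReal) (fun a b => pmf_toReal_mem (ch.up a b)) hτ₁ hτ₂ hτ₃
  obtain ⟨δ', hδ', hbc⟩ := exists_broadcast_block_code (pmf_toReal_mem pR)
    (W₁ := fun a y => (ch.down1 a y).toReal) (fun a => pmf_toReal_mem (ch.down1 a))
    (W₂ := fun a y => (ch.down2 a y).toReal) (fun a => pmf_toReal_mem (ch.down2 a)) hσ₁ hσ₂
  refine ⟨fun n =>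
    (δ n + ((numMessages r12 n : ℝ) - 1) * ((2 : ℝ) ^ (n * τ₁))⁻¹ +
      ((numMessages r21 n : ℝ) - 1) * ((2 : ℝ) ^ (n * τ₂))⁻¹ +
      ((numMessages r12 n : ℝ) - 1) * ((numMessages r21 n : ℝ) - 1) *
        ((2 : ℝ) ^ (n * τ₃))⁻¹) +
    (δ' n + ((numMessages r21 n : ℝ) - 1) * ((2 : ℝ) ^ (n * σ₁))⁻¹ +
      ((numMessages r12 n : ℝ) - 1) * ((2 : ℝ) ^ (n * σ₂))⁻¹), ?_, fun n => ?_⟩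
  · simpa using ((((hδ.add (tendsto_numMessages hr₁)).add (tendsto_numMessages hr₂)).add
      (tendsto_numMessages_mul hr₃))).add
        ((hδ'.add (tendsto_numMessages hs₁)).add (tendsto_numMessages hs₂))
  obtain ⟨c, d, dec, h⟩ := hmac n (K := Fin (numMessages r12 n)) (L := Fin (numMessages r21 n))
  obtain ⟨e, dec₁, dec₂, h'⟩ := hbc n
    -- A random codebook needs a finite index set. Indices outside the range of `relayIndex` are
    -- never sent and get an arbitrary constant word.
    (J := Set.range (relayIndex (M12 := numMessages r12 n) (M21 := numMessages r21 n)))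
    (fun k l => ⟨relayIndex (k, l), Set.mem_range_self _⟩)
    (fun k l l' hl => relayIndex_injective_snd k (congrArg Subtype.val hl))
    (fun l k k' hk => relayIndex_injective_fst l (congrArg Subtype.val hk))
  simp only [Fintype.card_fin] at h h'
  obtain ⟨a, -⟩ := p12.support_nonempty
  obtain ⟨b, -⟩ := p21.support_nonempty
  obtain ⟨x, -⟩ := pR.support_nonempty
  classical
  let s : DFScheme X12 X21 XR YR Y1 Y2 n (numMessages r12 n) (numMessages r21 n) :=
    { x12 := c
      x21 := d
      decR := dec
      xR := fun i => if hi : i ∈ Set.range relayIndex then e ⟨i, hi⟩ else fun _ => x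
      dec1 := dec₁
      dec2 := dec₂
      idle12 := a
      idle21 := b
      idleR := x }
  have hxR : ∀ w, s.xR (relayIndex w) = e ⟨relayIndex w, Set.mem_range_self _⟩ := fun w =>
    dif_pos (Set.mem_range_self w)
  have hd : (pairAverage fun m m' => s.blockError1 ch m m' + s.blockError2 ch m m') ≤
      δ' n + ((numMessages r21 n : ℝ) - 1) * ((2 : ℝ) ^ (n * σ₁))⁻¹ +
        ((numMessages r12 n : ℝ) - 1) * ((2 : ℝ) ^ (n * σ₂))⁻¹ := by
    unfold DFScheme.blockError1 DFScheme.blockError2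
    simp only [hxR]
    exact h'
  have hu : pairAverage (s.relayBlockError ch) ≤ _ := h
  have hd1 : pairAverage (s.blockError1 ch) ≤ _ := (pairAverage_mono fun k l =>
    le_add_of_nonneg_right (s.blockError2_nonneg ch k l)).trans hd
  have hd2 : pairAverage (s.blockError2 ch) ≤ _ := (pairAverage_mono fun k l =>
    le_add_of_nonneg_left (s.blockError1_nonneg ch k l)).trans hd
  have hd0 : 0 ≤ pairAverage (s.blockError1 ch) :=
    mul_nonneg (by positivity) (Finset.sum_nonneg fun k _ => Finset.sum_nonneg fun l _ =>
      s.blockError1_nonneg ch k l)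
  refine ⟨s, ?_, ?_, ?_⟩
  · linarith
  · rw [pairAverage_add]; linarith
  · rw [pairAverage_add]; linarith

/-- Scaled down points of the decode-and-forward region are achieved. -/
theorem dfAchievable_smul (ch : Channel X12 X21 XR YR Y1 Y2) (p12 : PMF X12) (p21 : PMF X21)
    (pR : PMF XR) {R : ℝ × ℝ} (hR : R ∈ dfRegion ch p12 p21 pR) {c : ℝ} (hc0 : 0 ≤ c)
    (hc1 : c < 1) : DFAchievable ch (c • R) := by
  obtain ⟨h1, h2, h12, h21, hs⟩ := hR
  -- Blocks run at rates `μ • R`, below the bounds because `μ < 1`. The gap from `c` to `μ` pays for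
  -- the extra pipelining block and for rounding `N` to whole blocks.
  obtain ⟨μ, hcμ, hμ1⟩ := exists_between hc1
  have hμ0 : 0 < μ := hc0.trans_lt hcμ
  have hlt : ∀ {r I : ℝ}, 0 ≤ r → r ≤ I → μ * r = 0 ∨ μ * r < I := by
    intro r I hr hI
    obtain h | h := hr.eq_or_lt
    · exact Or.inl (by rw [← h, mul_zero])
    · exact Or.inr (lt_of_lt_of_le (by nlinarith) hI)
  have hsum : μ * R.1 = 0 ∨ μ * R.2 = 0 ∨ μ * R.1 + μ * R.2 <
      mutualInfo fun (x : X12 × X21) y => upLaw ch p12 p21 x.1 x.2 y := by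
    obtain h | h := hlt (add_nonneg h1 h2) hs
    -- A vanishing sum of nonnegative rates forces both rates to vanish.
    · left
      nlinarith [mul_nonneg hμ0.le h1, mul_nonneg hμ0.le h2]
    · exact Or.inr (Or.inr (by rwa [← mul_add]))
  obtain ⟨δ, hδ, hscheme⟩ := exists_scheme ch p12 p21 pR (hlt h1 (h12.trans (min_le_left _ _)))
    (hlt h1 (h12.trans (min_le_right _ _))) (hlt h2 (h21.trans (min_le_left _ _)))
    (hlt h2 (h21.trans (min_le_right _ _))) hsum
  -- `B` depends on neither `ε` nor `N`, so the factor `B` in the error bounds is beaten by the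
  -- vanishing block error.
  obtain ⟨B, hB⟩ : ∃ B : ℕ, c < μ * ((B : ℝ) / (B + 1)) := by
    have h := (tendsto_natCast_div_add_atTop (1 : ℝ)).const_mul μ
    rw [mul_one] at h
    exact (h.eventually_const_lt hcμ).exists
  refine ⟨mul_nonneg hc0 h1, mul_nonneg hc0 h2, fun ε hε => ?_⟩
  have hdiv : Filter.Tendsto (fun N : ℕ => N / (B + 1)) Filter.atTop Filter.atTop :=
    Nat.tendsto_div_const_atTop (Nat.succ_ne_zero B)
  have hB1 : (0 : ℝ) < B + 1 := by positivity
  have ev1 : ∀ᶠ N : ℕ in Filter.atTop, δ (N / (B + 1)) < ε / (B + 1) :=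
    (hδ.comp hdiv).eventually_lt_const (by positivity)
  have ev2 : ∀ᶠ N : ℕ in Filter.atTop, 0 < N / (B + 1) := hdiv.eventually_gt_atTop 0
  -- Since `n ≥ N/(B+1) - 1`, rounding lowers `n * B * μ` by at most `μ * B`; from this `N` on, the
  -- slack `N * (μ * (B/(B+1)) - c)` covers the loss.
  have ev3 : ∀ᶠ N : ℕ in Filter.atTop,
      μ * B / (μ * ((B : ℝ) / (B + 1)) - c) ≤ (N : ℝ) :=
    tendsto_natCast_atTop_atTop.eventually_ge_atTop _
  filter_upwards [ev1, ev2, ev3] with N hN1 hN2 hN3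
  set n := N / (B + 1) with hn
  obtain ⟨s, e0, e1, e2⟩ := hscheme n
  have hN : (B + 1) * n ≤ N := Nat.mul_div_le N (B + 1)
  have hlen : (N : ℝ) * c ≤ n * B * μ := by
    rw [div_le_iff₀ (by linarith)] at hN3
    have h3 : N < (B + 1) * (n + 1) := by
      rw [hn, mul_add, mul_one]
      exact Nat.lt_mul_div_succ N (Nat.succ_pos B)
    have h4 : (N : ℝ) < (B + 1) * (n + 1) := by exact_mod_cast h3
    have h5 : (N : ℝ) / (B + 1) ≤ n + 1 := by rw [div_le_iff₀ hB1]; linarith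
    have h6 : μ * B * (N / (B + 1)) ≤ μ * B * (n + 1) :=
      mul_le_mul_of_nonneg_left h5 (by positivity)
    have h7 : (N : ℝ) * (μ * (B / (B + 1))) = μ * B * (N / (B + 1)) := by ring
    nlinarith
  have hrate : ∀ r : ℝ, 0 ≤ r → (2 : ℝ) ^ ((N : ℝ) * (c * r)) ≤
      (Fintype.card (Fin B → Fin (numMessages (μ * r) n)) : ℝ) := by
    intro r hr
    rw [Fintype.card_fun, Fintype.card_fin, Fintype.card_fin, Nat.cast_pow]
    calc (2 : ℝ) ^ ((N : ℝ) * (c * r)) ≤ (2 : ℝ) ^ (n * (μ * r) * B) :=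
          Real.rpow_le_rpow_of_exponent_le one_lt_two.le (by nlinarith)
      _ = ((2 : ℝ) ^ (n * (μ * r))) ^ B := by
          rw [Real.rpow_mul two_pos.le, Real.rpow_natCast]
      _ ≤ _ := pow_le_pow_left₀ (by positivity) (le_numMessages _ _) B
  have herr : ∀ x : ℝ, x ≤ δ n → (B : ℝ) * x ≤ ε := by
    intro x hx
    have h3 : (B : ℝ) * x ≤ B * (ε / (B + 1)) :=
      mul_le_mul_of_nonneg_left (hx.trans hN1.le) (by positivity)
    have h4 : (B : ℝ) * (ε / (B + 1)) ≤ (B + 1) * (ε / (B + 1)) :=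
      mul_le_mul_of_nonneg_right (by linarith) (by positivity)
    rw [mul_div_cancel₀ _ hB1.ne'] at h4
    linarith
  exact ⟨n, B, _, _, hN2, hN, s, ⟨hrate R.1 h1, hrate R.2 h2⟩,
    (s.relayError_le hN2 hN ch).trans (herr _ e0), (s.error1_le hN2 hN ch).trans (herr _ e1),
    (s.error2_le hN2 hN ch).trans (herr _ e2)⟩

end TwoWayRelay

end

theorem theorem1 {X12 X21 XR YR Y1 Y2 : Type*}
    [Fintype X12] [Fintype X21] [Fintype XR] [Fintype YR] [Fintype Y1] [Fintype Y2]
    (ch : TwoWayRelay.Channel X12 X21 XR YR Y1 Y2)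
    (p12 : PMF X12) (p21 : PMF X21) (pR : PMF XR) :
    closure (TwoWayRelay.dfRegion ch p12 p21 pR) ⊆
      closure {R : ℝ × ℝ | TwoWayRelay.DFAchievable ch R} := by
  refine closure_minimal (fun R hR => ?_) isClosed_closure
  -- The scalings `k/(k+1) < 1` give achieved pairs that converge to `R`.
  have h := (tendsto_natCast_div_add_atTop (1 : ℝ)).smul_const R
  rw [one_smul] at h
  refine mem_closure_of_tendsto h (Filter.Eventually.of_forall fun k => ?_)
  exact TwoWayRelay.dfAchievable_smul ch p12 p21 pR hR (by positivity)
    ((div_lt_one (by positivity)).mpr (by linarith))
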